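/- Let $q=3^r$ with $r\ge 1$, and let $n\ge1$. Let $J=\begin{bmatrix}0&1_n&0\\1_n&0&0\\0&0&1\end{bmatrix}$ and $O(2n+1,q)=\{w\in GL(2n+1,\mathbb F_q)\mid {}^twJw=J\}$. Let $Q$ be the subgroup of $O(2n+1,q)$ consisting of all $$\begin{bmatrix}A&0&0\\0&{}^tA^{-1}&0\\0&0&1\end{bmatrix}\begin{bmatrix}1_n&B&-{}^th\\0&1_n&0\\0&h&1\end{bmatrix},\qquad A\in GL(n,\mathbb F_q),\ B\in\mathbb F_q^{n\times n},\ h\in\mathbb F_q^{1\times n},\ B+{}^tB+{}^thh=0,$$ let $\rho=\mathrm{diag}(1_n,1_n,-1)$, and for $0\le s\le n$ let $\sigma_s\in O(2n+1,q)$ be the permutation matrix that interchanges the $i$-th and $(n+i)$-th basis vectors for $1\le i\le s$ and fixes the others. Put $$DC_1^-(n,q)=Q\sigma_{n-1}Q,\quad DC_2^-(n,q)=\rho\, Q\sigma_{n-1}Q\quad (n\ge1\text{ odd}),$$ $$DC_1^+(n,q)=Q\sigma_{n-2}Q,\quad DC_2^+(n,q)=\rho\, Q\sigma_{n-2}Q\quad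 (n\ge2\text{ even}).$$ For a subset $S\subseteq O(2n+1,q)$ and $\beta\in\mathbb F_q$ let $N_S(\beta)=|\{w\in S\mid \mathrm{Tr}\,w=\beta\}|$, and for $m\ge1$ let $$\delta(m,q;\beta)=|\{(\alpha_1,\dots,\alpha_m)\in(\mathbb F_q^*)^m\mid \alpha_1+\alpha_1^{-1}+\cdots+\alpha_m+\alpha_m^{-1}=\beta\}|.$$ With $\left[{n\atop s}\right]_q=\prod_{j=0}^{s-1}(q^{n-j}-1)/(q^{s-j}-1)$, put, for $n$ odd, $$A^-(n,q)=q^{\frac14(5n^2-1)}\left[{n\atop 1}\right]_q\prod_{j=1}^{(n-1)/2}(q^{2j-1}-1),\qquad B^-(n,q)=q^{\frac14(n-1)^2}(q^n-1)\prod_{j=1}^{(n-1)/2}(q^{2j}-1),$$ and, for $n\ge 2$ even, $$A^+(n,q)=q^{\frac14(5n^2-2n)}\left[{n\atop 2}\right]_q\prod_{j=1}^{(n-2)/2}(q^{2j-1}-1),\qquad B^+(n,q)=q^{\frac14(n-2)^2}(q^n-1)(q^{n-1}-1)\prod_{j=1}^{(n-2)/2}(q^{2j}-1).$$ Then for all $\beta\in\mathbb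 F_q$: (1) for every odd $n\ge1$, $$N_{DC_1^-(n,q)}(\beta)=q^{-1}A^-(n,q)B^-(n,q)+q^{-1}A^-(n,q)\bigl(q\,\delta(1,q;\beta-1)-q+1\bigr)$$ $$=q^{-1}A^-(n,q)B^-(n,q)+q^{-1}A^-(n,q)\times\begin{cases}q+1,&\text{if }\beta^2-2\beta\ne0\text{ is a square},\\1,&\text{if }\beta=0\text{ or }2,\\-q+1,&\text{if }\beta^2-2\beta\text{ is a nonsquare};\end{cases}$$ (2) for every odd $n\ge1$, $$N_{DC_2^-(n,q)}(\beta)=q^{-1}A^-(n,q)B^-(n,q)+q^{-1}A^-(n,q)\bigl(q\,\delta(1,q;\beta+1)-q+1\bigr)$$ $$=q^{-1}A^-(n,q)B^-(n,q)+q^{-1}A^-(n,q)\times\begin{cases}q+1,&\text{if }\beta^2+2\beta\ne0\text{ is a square},\\1,&\text{if }\beta=0\text{ or }1,\\-q+1,&\text{if }\beta^2+2\beta\text{ is a nonsquare};\end{cases}$$ (3) for every even $n\ge2$, $$N_{DC_1^+(n,q)}(\beta)=q^{-1}A^+(n,q)B^+(n,q)+q^{-1}A^+(n,q)\times\begin{cases}q\,\delta(2,q;0)+(q-1)^3,&\text{if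 }\beta=1,\\q\,\delta(2,q;\beta-1)-2q^2+3q-1,&\text{if }\beta\ne1;\end{cases}$$ (4) for every even $n\ge2$, $$N_{DC_2^+(n,q)}(\beta)=q^{-1}A^+(n,q)B^+(n,q)+q^{-1}A^+(n,q)\times\begin{cases}q\,\delta(2,q;0)+(q-1)^3,&\text{if }\beta=-1,\\q\,\delta(2,q;\beta+1)-2q^2+3q-1,&\text{if }\beta\ne-1.\end{cases}$$ -/

import Mathlib

open Matrix

namespace DoubleCosetTrace

/-- Row and column index of a `(2n+1) × (2n+1)` matrix in block form with block sizes `n, n, 1`. -/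
abbrev Idx (n : ℕ) : Type := (Fin n ⊕ Fin n) ⊕ Unit

section Groups

variable (n : ℕ) (F : Type*) [Field F]

/-- The symmetric matrix `J = [[0, 1ₙ, 0], [1ₙ, 0, 0], [0, 0, 1]]`. -/
def JMat : Matrix (Idx n) (Idx n) F :=
  fromBlocks (fromBlocks 0 1 1 0) 0 0 1

/-- The orthogonal group `O(2n+1, F) = {w ∈ GL(2n+1, F) | ᵗw J w = J}`. -/
def OGroup : Subgroup (GL (Idx n) F) where
  carrier := {w | (w : Matrix (Idx n) (Idx n) F)ᵀ * JMat n F * (w : Matrix (Idx n) (Idx n) F) = JMat n F}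
  one_mem' := by simp
  mul_mem' := by
    intro a b ha hb
    simp only [Set.mem_ofPred_eq] at ha hb ⊢
    calc ((a * b : GL (Idx n) F) : Matrix (Idx n) (Idx n) F)ᵀ * JMat n F * (a * b : GL (Idx n) F)
        = (b : Matrix (Idx n) (Idx n) F)ᵀ *
            ((a : Matrix (Idx n) (Idx n) F)ᵀ * JMat n F * (a : Matrix (Idx n) (Idx n) F)) *
            (b : Matrix (Idx n) (Idx n) F) := by
          simp only [Units.val_mul, transpose_mul, Matrix.mul_assoc]
      _ = JMat n F := by rw [ha, hb]
  inv_mem' := by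
    intro a ha
    simp only [Set.mem_ofPred_eq] at ha ⊢
    have h1 : (a : Matrix (Idx n) (Idx n) F) * ((a⁻¹ : GL (Idx n) F) : Matrix _ _ F) = 1 :=
      a.mul_inv
    have h2 : ((a⁻¹ : GL (Idx n) F) : Matrix _ _ F)ᵀ * (a : Matrix (Idx n) (Idx n) F)ᵀ = 1 := by
      rw [← transpose_mul, h1, transpose_one]
    calc ((a⁻¹ : GL (Idx n) F) : Matrix _ _ F)ᵀ * JMat n F * ((a⁻¹ : GL (Idx n) F) : Matrix _ _ F)
        = (((a⁻¹ : GL (Idx n) F) : Matrix _ _ F)ᵀ * (a : Matrix (Idx n) (Idx n) F)ᵀ) * JMat n F *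
          ((a : Matrix (Idx n) (Idx n) F) * ((a⁻¹ : GL (Idx n) F) : Matrix _ _ F)) := by
          conv_lhs => rw [← ha]
          simp only [Matrix.mul_assoc]
      _ = JMat n F := by rw [h1, h2, Matrix.one_mul, Matrix.mul_one]

variable {n F}

/-- The matrix in `GL(2n+1, F)` underlying an element of `O(2n+1, F)`. -/
def toMat (w : OGroup n F) : Matrix (Idx n) (Idx n) F :=
  ((w : GL (Idx n) F) : Matrix (Idx n) (Idx n) F)

/-- A matrix `M` with `M² = 1` and `ᵗM J M = J`, as an element of `O(2n+1, F)`. -/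
def ofInvolution (M : Matrix (Idx n) (Idx n) F) (h : M * M = 1)
    (hJ : Mᵀ * JMat n F * M = JMat n F) : OGroup n F :=
  ⟨⟨M, M, h, h⟩, hJ⟩

/-- The block diagonal matrix `diag(A, ᵗA⁻¹, 1)`. -/
def leviMat (A : GL (Fin n) F) : Matrix (Idx n) (Idx n) F :=
  fromBlocks
    (fromBlocks (A : Matrix (Fin n) (Fin n) F) 0 0 ((A⁻¹ : GL (Fin n) F) : Matrix (Fin n) (Fin n) F)ᵀ)
    0 0 1

/-- The matrix `[[1ₙ, B, -ᵗh], [0, 1ₙ, 0], [0, h, 1]]`. -/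
def unipMat (B : Matrix (Fin n) (Fin n) F) (h : Matrix Unit (Fin n) F) :
    Matrix (Idx n) (Idx n) F :=
  fromBlocks (fromBlocks 1 B 0 1) (fromRows (-hᵀ) 0) (fromCols 0 h) 1

variable (n F)

/-- The subgroup `Q(2n+1, F)`, of index 2 in a maximal parabolic subgroup of `O(2n+1, F)`: all
`diag(A, ᵗA⁻¹, 1) * [[1ₙ, B, -ᵗh], [0, 1ₙ, 0], [0, h, 1]]` with `A ∈ GL(n, F)` and
`B + ᵗB + ᵗh h = 0`. -/
def Q : Set (OGroup n F) :=
  {w | ∃ (A : GL (Fin n) F) (B : Matrix (Fin n) (Fin n) F) (h : Matrix Unit (Fin n) F),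
    B + Bᵀ + hᵀ * h = 0 ∧ toMat w = leviMat A * unipMat B h}

/-- `ρ = diag(1ₙ, 1ₙ, -1)`. -/
def rho : OGroup n F :=
  ofInvolution (fromBlocks 1 0 0 (-1))
    (by simp [fromBlocks_multiply])
    (by simp [JMat, fromBlocks_transpose, fromBlocks_multiply])

/-- The `n × n` matrix `diag(1_r, 0)`. -/
def topId (r : ℕ) : Matrix (Fin n) (Fin n) F :=
  diagonal fun i => if (i : ℕ) < r then 1 else 0

theorem topId_transpose (r : ℕ) : (topId n F r)ᵀ = topId n F r := by
  simp [topId]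

theorem topId_mul_self (r : ℕ) : topId n F r * topId n F r = topId n F r := by
  simp [topId]

/-- `σ_r`: it interchanges the `i`-th basis vectors of the two blocks of size `n`, for the first `r`
values of `i`, and fixes all other basis vectors. -/
def sigma (r : ℕ) : OGroup n F :=
  ofInvolution
    (fromBlocks
      (fromBlocks (1 - topId n F r) (topId n F r) (topId n F r) (1 - topId n F r)) 0 0 1)
    (by
      simp [fromBlocks_multiply, Matrix.mul_sub, Matrix.sub_mul, topId_mul_self])
    (by
      simp [JMat, fromBlocks_transpose, fromBlocks_multiply, Matrix.mul_sub, Matrix.sub_mul,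
        topId_mul_self, topId_transpose])

/-- `DC₁⁻(n, q) = Q σ_{n-1} Q` (used for odd `n`). -/
def DC1minus : Set (OGroup n F) := DoubleCoset.doubleCoset (sigma n F (n - 1)) (Q n F) (Q n F)

/-- `DC₂⁻(n, q) = ρ Q σ_{n-1} Q` (used for odd `n`). -/
def DC2minus : Set (OGroup n F) :=
  (fun w => rho n F * w) '' DoubleCoset.doubleCoset (sigma n F (n - 1)) (Q n F) (Q n F)

/-- `DC₁⁺(n, q) = Q σ_{n-2} Q` (used for even `n ≥ 2`). -/
def DC1plus : Set (OGroup n F) := DoubleCoset.doubleCoset (sigma n F (n - 2)) (Q n F) (Q n F)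

/-- `DC₂⁺(n, q) = ρ Q σ_{n-2} Q` (used for even `n ≥ 2`). -/
def DC2plus : Set (OGroup n F) :=
  (fun w => rho n F * w) '' DoubleCoset.doubleCoset (sigma n F (n - 2)) (Q n F) (Q n F)

variable {n F}

/-- `N_S(β)`: the number of `w ∈ S` with `Tr w = β`. -/
noncomputable def N (S : Set (OGroup n F)) (β : F) : ℕ :=
  {w | w ∈ S ∧ (toMat w).trace = β}.ncard

/-- `δ(m, q; β)`: the number of `(α₁, …, α_m) ∈ (F^*)^m` with
`α₁ + α₁⁻¹ + ⋯ + α_m + α_m⁻¹ = β`. -/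
noncomputable def delta (m : ℕ) (β : F) : ℕ :=
  {α : Fin m → Fˣ | ∑ i, ((α i : F) + (((α i)⁻¹ : Fˣ) : F)) = β}.ncard

end Groups

section Constants

/-- The `q`-binomial coefficient `∏_{j=0}^{r-1} (q^{n-j} - 1) / (q^{r-j} - 1)`, for `r ≤ n`. -/
def qBinom (q : ℚ) (n r : ℕ) : ℚ :=
  ∏ j ∈ Finset.range r, (q ^ (n - j) - 1) / (q ^ (r - j) - 1)

/-- `A⁻(n, q)`, for odd `n`; the division in the exponent is then exact. -/
def Aminus (n : ℕ) (q : ℚ) : ℚ :=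
  q ^ ((5 * n ^ 2 - 1) / 4) * qBinom q n 1 * ∏ j ∈ Finset.Icc 1 ((n - 1) / 2), (q ^ (2 * j - 1) - 1)

/-- `B⁻(n, q)`, for odd `n`; the division in the exponent is then exact. -/
def Bminus (n : ℕ) (q : ℚ) : ℚ :=
  q ^ ((n - 1) ^ 2 / 4) * (q ^ n - 1) * ∏ j ∈ Finset.Icc 1 ((n - 1) / 2), (q ^ (2 * j) - 1)

/-- `A⁺(n, q)`, for even `n ≥ 2`; the division in the exponent is then exact. -/
def Aplus (n : ℕ) (q : ℚ) : ℚ :=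
  q ^ ((5 * n ^ 2 - 2 * n) / 4) * qBinom q n 2 *
    ∏ j ∈ Finset.Icc 1 ((n - 2) / 2), (q ^ (2 * j - 1) - 1)

/-- `B⁺(n, q)`, for even `n ≥ 2`; the division in the exponent is then exact. -/
def Bplus (n : ℕ) (q : ℚ) : ℚ :=
  q ^ ((n - 2) ^ 2 / 4) * (q ^ n - 1) * (q ^ (n - 1) - 1) *
    ∏ j ∈ Finset.Icc 1 ((n - 2) / 2), (q ^ (2 * j) - 1)

end Constants

end DoubleCosetTrace

open DoubleCosetTrace

set_option linter.unusedSectionVars false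

namespace DoubleCosetTrace

/-! Let `σ = σ_r`. Counting pairs `(x, y) ∈ Q × Q` with `Tr(xσy) = β` in two ways passes from the
double coset `QσQ` to the single coset `Qσ`: the fibres of `(x, y) ↦ xσy` all have the size of `Q ∩
σQσ⁻¹`, and `Tr(xσy) = Tr(yxσ)` (`card_doubleCoset_mul_card`, `N_doubleCoset_mul_card`).

In characteristic 3 the relation `B + ᵗB + ᵗh h = 0` says exactly that `B - ᵗh h` is antisymmetric,
so `Q` is parametrised freely by triples `(A, C, v)` with `C` antisymmetric and `B = C + v ᵗv`. With
`E = diag(1_r, 0)`, the trace of `wσ` is `Tr(EAC)` plus a part independent of `C`. If `EA` is not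
symmetric, `C ↦ Tr(EAC)` is a nonzero linear functional and the trace is equidistributed. If `EA` is
symmetric, the functional vanishes and `A` is block lower triangular with diagonal blocks `S`
(symmetric, size `r`) and `T` (size `k = n - r`); the trace is then `ᵗv₁Sv₁ + Tr T + Tr T⁻¹ + 1`,
where `v₁` consists of the first `r` entries of `v` (`card_traceEq`,
`diagonalTrace_symmetricUpperEquiv`).

For `r` even, the number of pairs `(S, v₁)` with `ᵗv₁Sv₁ = c` is the same for all `c ≠ 0` and is
larger by exactly the number of `S` when `c = 0` (`quadCount_zero_eq`). Hence β enters only through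
the number of `T ∈ GL_k` with `Tr T + Tr T⁻¹ = β - 1` (`N_doubleCoset_sigma`). For `k = 1` this is
`δ(1, q; β - 1)`; for `k = 2` it is found by sorting `T` by trace and determinant
(`kloostermanCount_two`). Counting invertible symmetric matrices by Schur complements
(`card_symInv_closed`) turns the remaining factors into `A^±` and `B^±`. Finally `-ρ ∈ Q`, so `ρQσQ
= -QσQ` and the second family follows by `β ↦ -β` (`N_rho_doubleCoset`). -/

/-! ### Counting in a double coset. -/

/-- A map between finite types all of whose fibres have the same cardinality. -/
theorem card_eq_mul_of_card_fiber {α β : Type*} [Finite α] [Finite β] (f : α → β) (c : ℕ)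
    (h : ∀ b, Nat.card {a // f a = b} = c) : Nat.card α = Nat.card β * c := by
  classical
  have := Fintype.ofFinite β
  rw [← Nat.card_congr (Equiv.sigmaFiberEquiv f), Nat.card_sigma]
  simp [h, Nat.card_eq_fintype_card]

/-- The elements of a double coset `H σ H` satisfying a conjugation invariant property. -/
theorem card_doubleCoset_mul_card {G : Type*} [Group G] [Finite G] (H : Subgroup G) (σ : G)
    (P : G → Prop) (hP : ∀ a b, P (a * b) → P (b * a)) :
    Nat.card {w // w ∈ DoubleCoset.doubleCoset σ (H : Set G) H ∧ P w} *
        Nat.card {x : H // σ⁻¹ * x * σ ∈ H} =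
      Nat.card H * Nat.card {x : H // P (x * σ)} := by
  -- Double counting of `X`. Conjugating by the second component, `(x, y) ↦ (y, yx)` turns `P (xσy)`
  -- into `P ((yx)σ)`, with `y` free.
  let X := {p : H × H // P (p.1 * σ * p.2)}
  have e1 : Nat.card X = Nat.card H * Nat.card {x : H // P (x * σ)} := by
    rw [← Nat.card_prod]
    refine Nat.card_congr
      { toFun := fun p => (p.1.2, ⟨p.1.2 * p.1.1, ?_⟩)
        invFun := fun p => ⟨(p.1⁻¹ * p.2.1, p.1), ?_⟩
        left_inv := fun p => ?_
        right_inv := fun p => ?_ }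
    · have := hP _ _ p.2
      simpa [mul_assoc] using this
    · have h1 := p.2.2
      have : P ((p.1 : G) * (((p.1 : G))⁻¹ * p.2.1 * σ)) := by simpa [mul_assoc] using h1
      simpa [mul_assoc] using hP _ _ this
    · ext <;> simp
    · ext <;> simp
  rw [← e1]
  symm
  let f : X → {w // w ∈ DoubleCoset.doubleCoset σ (H : Set G) H ∧ P w} := fun p =>
    ⟨p.1.1 * σ * p.1.2, DoubleCoset.mem_doubleCoset.2 ⟨p.1.1, p.1.1.2, p.1.2, p.1.2.2, rfl⟩, p.2⟩
  refine card_eq_mul_of_card_fiber f _ ?_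
  rintro ⟨w, hw, hPw⟩
  obtain ⟨x, hx, y, hy, rfl⟩ := DoubleCoset.mem_doubleCoset.1 hw
  -- The fibre over `xσy` is a translate of `H ∩ σHσ⁻¹`: its points are `(xz, (σ⁻¹zσ)⁻¹y)`.
  refine Nat.card_congr
    { toFun := fun p => ⟨⟨x⁻¹ * p.1.1.1, H.mul_mem (H.inv_mem hx) p.1.1.1.2⟩, ?_⟩
      invFun := fun z => ⟨⟨(⟨x * z.1, H.mul_mem hx z.1.2⟩,
          ⟨(σ⁻¹ * z.1 * σ)⁻¹ * y, H.mul_mem (H.inv_mem z.2) hy⟩), ?_⟩, ?_⟩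
      left_inv := fun p => ?_
      right_inv := fun z => ?_ }
  · have h1 : (p.1.1.1 : G) * σ * p.1.1.2 = x * σ * y := congrArg Subtype.val p.2
    have : σ⁻¹ * (x⁻¹ * p.1.1.1) * σ = y * (p.1.1.2 : G)⁻¹ := by
      rw [eq_mul_inv_of_mul_eq (eq_mul_inv_of_mul_eq h1)]; group
    change σ⁻¹ * (x⁻¹ * p.1.1.1) * σ ∈ H
    rw [this]
    exact H.mul_mem hy (H.inv_mem p.1.1.2.2)
  · change P (x * z.1 * σ * ((σ⁻¹ * z.1 * σ)⁻¹ * y))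
    convert hPw using 1
    group
  · apply Subtype.ext
    change x * z.1 * σ * ((σ⁻¹ * z.1 * σ)⁻¹ * y) = x * σ * y
    group
  · have h1 : (p.1.1.1 : G) * σ * p.1.1.2 = x * σ * y := congrArg Subtype.val p.2
    ext
    · simp
    · change (σ⁻¹ * (x⁻¹ * p.1.1.1) * σ)⁻¹ * y = p.1.1.2
      rw [eq_mul_inv_of_mul_eq (eq_mul_inv_of_mul_eq h1)]; group
  · ext
    simp

/-! ### The group `Q`, its parametrisation, and conjugation by `σ_r`. -/

section Parabolic

variable {n : ℕ} {F : Type*} [Field F]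

theorem toMat_mul (v w : OGroup n F) : toMat (v * w) = toMat v * toMat w := rfl

theorem toMat_injective : Function.Injective (toMat : OGroup n F → _) := fun _ _ h =>
  Subtype.ext (Units.ext h)

theorem JMat_mul_self : JMat n F * JMat n F = 1 := by
  simp [JMat, fromBlocks_multiply]

theorem toMat_mem (w : OGroup n F) : (toMat w)ᵀ * JMat n F * toMat w = JMat n F := w.2

/-- Since `J² = 1`, preserving the form makes `J ᵗM J` an inverse of `M`, so invertibility need not
be assumed. -/
theorem exists_toMat_eq {M : Matrix (Idx n) (Idx n) F} (h : Mᵀ * JMat n F * M = JMat n F) :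
    ∃ w : OGroup n F, toMat w = M := by
  have h1 : (JMat n F * Mᵀ * JMat n F) * M = 1 := by
    rw [Matrix.mul_assoc (JMat n F), Matrix.mul_assoc (JMat n F), h, JMat_mul_self]
  exact ⟨⟨⟨M, JMat n F * Mᵀ * JMat n F, mul_eq_one_comm.1 h1, h1⟩, h⟩, rfl⟩

theorem toMat_inv (w : OGroup n F) : toMat w⁻¹ = JMat n F * (toMat w)ᵀ * JMat n F := by
  have h1 : (JMat n F * (toMat w)ᵀ * JMat n F) * toMat w = 1 := by
    rw [Matrix.mul_assoc (JMat n F), Matrix.mul_assoc (JMat n F), toMat_mem, JMat_mul_self]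
  have h2 : toMat w * toMat w⁻¹ = 1 := by
    rw [← toMat_mul, mul_inv_cancel]; rfl
  exact (left_inv_eq_right_inv h1 h2).symm

/-- Block matrices of the shape of the elements of `Q`. -/
def parabolicMat (a b d : Matrix (Fin n) (Fin n) F) (c : Matrix (Fin n) Unit F)
    (h : Matrix Unit (Fin n) F) : Matrix (Idx n) (Idx n) F :=
  fromBlocks (fromBlocks a b 0 d) (fromRows c 0) (fromCols 0 h) 1

theorem leviMat_mul_unipMat (A : GL (Fin n) F) (B : Matrix (Fin n) (Fin n) F)
    (h : Matrix Unit (Fin n) F) :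
    leviMat A * unipMat B h =
      parabolicMat (A : Matrix (Fin n) (Fin n) F) ((A : Matrix (Fin n) (Fin n) F) * B)
        ((A⁻¹ : GL (Fin n) F) : Matrix (Fin n) (Fin n) F)ᵀ
        (-((A : Matrix (Fin n) (Fin n) F) * hᵀ)) h := by
  simp [leviMat, unipMat, parabolicMat, fromBlocks_multiply, fromBlocks_mul_fromRows]

theorem parabolicMat_mul (a b d : Matrix (Fin n) (Fin n) F) (c : Matrix (Fin n) Unit F)
    (h : Matrix Unit (Fin n) F) (a' b' d' : Matrix (Fin n) (Fin n) F) (c' : Matrix (Fin n) Unit F)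
    (h' : Matrix Unit (Fin n) F) :
    parabolicMat a b d c h * parabolicMat a' b' d' c' h' =
      parabolicMat (a * a') (a * b' + b * d' + c * h') (d * d') (a * c' + c) (h * d' + h') := by
  simp only [parabolicMat, fromBlocks_multiply, fromBlocks_mul_fromRows, fromCols_mul_fromBlocks,
    fromRows_mul_fromCols, fromCols_mul_fromRows, fromBlocks_add, Matrix.mul_zero, Matrix.zero_mul,
    add_zero, zero_add, Matrix.mul_one, Matrix.one_mul]
  congr 1 <;> ext i j <;> rcases i with i | i <;> rcases j with j | j <;> simp

/-- On the orthogonal group `w ↦ J ᵗw J` is inversion, so this is what closes `Q` under inverses. -/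
theorem J_transpose_J_parabolicMat (a b d : Matrix (Fin n) (Fin n) F) (c : Matrix (Fin n) Unit F)
    (h : Matrix Unit (Fin n) F) :
    JMat n F * (parabolicMat a b d c h)ᵀ * JMat n F = parabolicMat dᵀ bᵀ aᵀ hᵀ cᵀ := by
  simp [JMat, parabolicMat, fromBlocks_multiply, fromBlocks_mul_fromRows, fromCols_mul_fromBlocks,
    fromBlocks_transpose, transpose_fromRows, transpose_fromCols]

theorem parabolicMat_one : parabolicMat (1 : Matrix (Fin n) (Fin n) F) 0 1 0 0 = 1 := by
  simp [parabolicMat]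

theorem parabolicMat_inj {a b d a' b' d' : Matrix (Fin n) (Fin n) F} {c c' : Matrix (Fin n) Unit F}
    {h h' : Matrix Unit (Fin n) F} :
    parabolicMat a b d c h = parabolicMat a' b' d' c' h' ↔
      a = a' ∧ b = b' ∧ d = d' ∧ c = c' ∧ h = h' := by
  simp only [parabolicMat, fromBlocks_inj, fromRows_inj.eq_iff, fromCols_inj.eq_iff]
  tauto

/-- Multiplying by `J` turns the condition into `(J ᵗM J) M = 1`, a product of two matrices of the
parabolic shape. Of the five resulting block equations, two are transposes of others. -/
theorem transpose_J_parabolicMat_eq_iff (a b d : Matrix (Fin n) (Fin n) F)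
    (c : Matrix (Fin n) Unit F) (h : Matrix Unit (Fin n) F) :
    (parabolicMat a b d c h)ᵀ * JMat n F * parabolicMat a b d c h = JMat n F ↔
      dᵀ * a = 1 ∧ dᵀ * b + bᵀ * d + hᵀ * h = 0 ∧ dᵀ * c + hᵀ = 0 := by
  have key : (parabolicMat a b d c h)ᵀ * JMat n F * parabolicMat a b d c h = JMat n F ↔
      JMat n F * (parabolicMat a b d c h)ᵀ * JMat n F * parabolicMat a b d c h = 1 := by
    constructor
    · intro h1
      rw [Matrix.mul_assoc (JMat n F), Matrix.mul_assoc (JMat n F), h1, JMat_mul_self]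
    · intro h1
      have := congrArg (JMat n F * ·) h1
      simpa [← Matrix.mul_assoc, JMat_mul_self] using this
  rw [key, J_transpose_J_parabolicMat, parabolicMat_mul]
  constructor
  · intro h1
    rw [← parabolicMat_one, parabolicMat_inj] at h1
    exact ⟨h1.1, h1.2.1, h1.2.2.2.1⟩
  · rintro ⟨h1, h2, h3⟩
    have h4 : aᵀ * d = 1 := by simpa using congrArg transpose h1
    have h5 : cᵀ * d + h = 0 := by simpa using congrArg transpose h3
    rw [h1, h2, h3, h4, h5]
    exact parabolicMat_one

/-- Inside the orthogonal group the block shape alone, with corner entry exactly 1, forces `d =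
ᵗa⁻¹`, `c = -a ᵗh` and the relation on `B = a⁻¹b`. Membership in `Q` becomes a check on the shape.
-/
theorem mem_Q_iff (w : OGroup n F) :
    w ∈ Q n F ↔ ∃ a b d c h, toMat w = parabolicMat a b d c h := by
  constructor
  · rintro ⟨A, B, h, -, hw⟩
    rw [leviMat_mul_unipMat] at hw
    exact ⟨_, _, _, _, _, hw⟩
  · rintro ⟨a, b, d, c, h, hw⟩
    have hO := toMat_mem w
    rw [hw, transpose_J_parabolicMat_eq_iff] at hO
    obtain ⟨h1, h2, h3⟩ := hO
    have h1' : a * dᵀ = 1 := mul_eq_one_comm.1 h1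
    have h1'' : d * aᵀ = 1 := by simpa using congrArg transpose h1'
    have h3' : dᵀ * c = -hᵀ := eq_neg_of_add_eq_zero_left h3
    refine ⟨⟨a, dᵀ, h1', h1⟩, dᵀ * b, h, ?_, ?_⟩
    · rw [transpose_mul, transpose_transpose, h2]
    · rw [leviMat_mul_unipMat, hw, parabolicMat_inj]
      refine ⟨rfl, ?_, ?_, ?_, rfl⟩
      · rw [← Matrix.mul_assoc]
        simp [h1']
      · simp
      · rw [← Matrix.mul_neg, ← h3', ← Matrix.mul_assoc]
        simp [h1']

variable (n F) in
/-- `Q` as a subgroup of the orthogonal group. -/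
def QSubgroup : Subgroup (OGroup n F) where
  carrier := Q n F
  one_mem' := (mem_Q_iff _).2 ⟨1, 0, 1, 0, 0, parabolicMat_one.symm⟩
  mul_mem' := by
    intro v w hv hw
    rw [mem_Q_iff] at hv hw ⊢
    obtain ⟨a, b, d, c, h, hv⟩ := hv
    obtain ⟨a', b', d', c', h', hw⟩ := hw
    exact ⟨_, _, _, _, _, by rw [toMat_mul, hv, hw, parabolicMat_mul]⟩
  inv_mem' := by
    intro w hw
    rw [mem_Q_iff] at hw ⊢
    obtain ⟨a, b, d, c, h, hw⟩ := hw
    exact ⟨_, _, _, _, _, by rw [toMat_inv, hw, J_transpose_J_parabolicMat]⟩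

variable (F) in
/-- Antisymmetric matrices. -/
abbrev Antisymm (ι : Type*) : Type _ := {C : Matrix ι ι F // Cᵀ = -C}

variable (F) in
/-- Triples of an invertible matrix, an antisymmetric matrix and a vector. -/
abbrev ParabolicParam (ι : Type*) [Fintype ι] [DecidableEq ι] : Type _ :=
  GL ι F × Antisymm F ι × (ι → F)

variable (n F) in
/-- Parameters for the elements of `Q` in characteristic three. -/
abbrev QParam : Type _ := ParabolicParam F (Fin n)

theorem transpose_mul_self_replicateRow (v : Fin n → F) :
    (replicateRow Unit v)ᵀ * replicateRow Unit v = vecMulVec v v := by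
  ext i j
  simp [Matrix.mul_apply, vecMulVec_apply]

/-- The block `B` of the element of `Q` with the given parameters. -/
def QParam.upper (p : QParam n F) : Matrix (Fin n) (Fin n) F :=
  (p.2.1 : Matrix (Fin n) (Fin n) F) + vecMulVec p.2.2 p.2.2

/-- The matrix of the element of `Q` with the given parameters. -/
def QParam.mat (p : QParam n F) : Matrix (Idx n) (Idx n) F :=
  leviMat p.1 * unipMat p.upper (replicateRow Unit p.2.2)

/-- The antisymmetric parts cancel and `v ᵗv` occurs `1 + 1 + 1 = 0` times. -/
theorem QParam.rel (h3 : (3 : F) = 0) (p : QParam n F) :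
    p.upper + p.upperᵀ + (replicateRow Unit p.2.2)ᵀ * replicateRow Unit p.2.2 = 0 := by
  rw [transpose_mul_self_replicateRow, QParam.upper, transpose_add, p.2.1.2]
  ext i j
  simp only [Matrix.add_apply, Matrix.neg_apply, vecMulVec_apply, transpose_apply,
    Matrix.zero_apply]
  linear_combination p.2.2 i * p.2.2 j * h3

theorem QParam.exists_toMat (h3 : (3 : F) = 0) (p : QParam n F) :
    ∃ w : QSubgroup n F, toMat (w : OGroup n F) = p.mat := by
  have hrel := p.rel h3
  have : p.matᵀ * JMat n F * p.mat = JMat n F := by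
    rw [QParam.mat, leviMat_mul_unipMat, transpose_J_parabolicMat_eq_iff]
    simp only [transpose_transpose, ← Matrix.mul_assoc, Units.inv_mul, Matrix.mul_neg,
      Matrix.one_mul, neg_add_cancel, and_true, true_and]
    rw [transpose_mul, Matrix.mul_assoc, ← transpose_mul, Units.inv_mul, transpose_one,
      Matrix.mul_one]
    exact hrel
  obtain ⟨w, hw⟩ := exists_toMat_eq this
  exact ⟨⟨w, p.1, _, _, hrel, hw⟩, hw⟩

theorem QParam.mat_injective : Function.Injective (QParam.mat : QParam n F → _) := by
  rintro ⟨A, ⟨C, hC⟩, v⟩ ⟨A', ⟨C', hC'⟩, v'⟩ h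
  simp only [QParam.mat, QParam.upper, leviMat_mul_unipMat, parabolicMat_inj] at h
  obtain ⟨hA, hB, -, -, hv⟩ := h
  obtain rfl := Units.ext hA
  obtain rfl : v = v' := funext fun i => congrFun (congrFun hv ()) i
  have := congrArg (((A⁻¹ : GL (Fin n) F) : Matrix (Fin n) (Fin n) F) * ·) hB
  simp only [← Matrix.mul_assoc, Units.inv_mul, Matrix.one_mul, add_left_inj] at this
  simp [this]

/-- `Q` is parametrised by `QParam`. -/
noncomputable def QParam.equiv (h3 : (3 : F) = 0) : QParam n F ≃ QSubgroup n F :=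
  Equiv.ofBijective (fun p => (p.exists_toMat h3).choose) <| by
    constructor
    · intro p p' h
      apply QParam.mat_injective
      rw [← (p.exists_toMat h3).choose_spec, ← (p'.exists_toMat h3).choose_spec]
      exact congrArg (fun w : QSubgroup n F => toMat (w : OGroup n F)) h
    · rintro ⟨w, A, B, h, hB, hw⟩
      have hh : replicateRow Unit (h ()) = h := by ext i j; rfl
      let p : QParam n F := ⟨A, ⟨B - vecMulVec (h ()) (h ()), by
        rw [← hh, transpose_mul_self_replicateRow] at hB
        ext i j
        have := congrFun (congrFun hB i) j
        simp only [Matrix.add_apply, transpose_apply, vecMulVec_apply, Matrix.zero_apply] at this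
        simp only [transpose_apply, Matrix.sub_apply, Matrix.neg_apply, vecMulVec_apply]
        linear_combination this - h () i * h () j * h3⟩, h ()⟩
      refine ⟨p, Subtype.ext (toMat_injective ?_)⟩
      rw [(p.exists_toMat h3).choose_spec, hw]
      simp [p, QParam.mat, QParam.upper, hh]

theorem QParam.toMat_equiv (h3 : (3 : F) = 0) (p : QParam n F) :
    toMat (QParam.equiv h3 p : OGroup n F) = p.mat :=
  (p.exists_toMat h3).choose_spec

theorem toMat_sigma (r : ℕ) : toMat (sigma n F r) = fromBlocks
    (fromBlocks (1 - topId n F r) (topId n F r) (topId n F r) (1 - topId n F r)) 0 0 1 := rfl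

theorem sigma_mul_self (r : ℕ) : sigma n F r * sigma n F r = 1 := by
  apply toMat_injective
  rw [toMat_mul, toMat_sigma]
  simp [fromBlocks_multiply, Matrix.mul_sub, Matrix.sub_mul, topId_mul_self]
  rfl

theorem sigma_inv (r : ℕ) : (sigma n F r)⁻¹ = sigma n F r :=
  inv_eq_of_mul_eq_one_left (sigma_mul_self r)

theorem trace_parabolicMat_mul_sigma (a b d : Matrix (Fin n) (Fin n) F)
    (c : Matrix (Fin n) Unit F) (h : Matrix Unit (Fin n) F) (r : ℕ) :
    (parabolicMat a b d c h * toMat (sigma n F r)).trace =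
      (a * (1 - topId n F r)).trace + (b * topId n F r).trace + (d * (1 - topId n F r)).trace + 1
    := by
  have ht : ∀ (x y z t : Matrix (Fin n) (Fin n) F) (u : Matrix (Fin n ⊕ Fin n) Unit F)
      (v : Matrix Unit (Fin n ⊕ Fin n) F),
      (fromBlocks (fromBlocks x y z t) u v (1 : Matrix Unit Unit F)).trace =
        x.trace + t.trace + 1 := by
    intros; simp [Matrix.trace, Fintype.sum_sum_type]
  rw [toMat_sigma, parabolicMat, fromBlocks_multiply]
  simp only [fromBlocks_multiply, Matrix.mul_zero, Matrix.mul_one, Matrix.zero_mul, add_zero,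
    zero_add, ht, trace_add]

theorem sigma_conj_parabolicMat_iff (a b d : Matrix (Fin n) (Fin n) F)
    (c : Matrix (Fin n) Unit F) (h : Matrix Unit (Fin n) F) (r : ℕ) :
    (∃ a' b' d' c' h', toMat (sigma n F r) * parabolicMat a b d c h * toMat (sigma n F r) =
      parabolicMat a' b' d' c' h') ↔
      topId n F r * a * (1 - topId n F r) = 0 ∧ topId n F r * b * topId n F r = 0 ∧
      (1 - topId n F r) * d * topId n F r = 0 ∧ h * topId n F r = 0 ∧ topId n F r * c = 0 := by
  rw [toMat_sigma]
  set E := topId n F r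
  have hE : E * E = E := topId_mul_self n F r
  have hE' : (1 - E) * E = 0 := by rw [Matrix.sub_mul, hE, Matrix.one_mul, sub_self]
  have hE'' : E * (1 - E) = 0 := by rw [Matrix.mul_sub, hE, Matrix.mul_one, sub_self]
  have hE3 : (1 - E) * (1 - E) = 1 - E := by rw [Matrix.mul_sub, hE', Matrix.mul_one, sub_zero]
  have hM : fromBlocks (fromBlocks (1 - E) E E (1 - E)) 0 0 1 * parabolicMat a b d c h *
      fromBlocks (fromBlocks (1 - E) E E (1 - E)) 0 0 1 =
      fromBlocks (fromBlocks ((1 - E) * a * (1 - E) + ((1 - E) * b + E * d) * E)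
        ((1 - E) * a * E + ((1 - E) * b + E * d) * (1 - E))
        (E * a * (1 - E) + (E * b + (1 - E) * d) * E)
        (E * a * E + (E * b + (1 - E) * d) * (1 - E)))
        (fromRows ((1 - E) * c) (E * c)) (fromCols (h * E) (h * (1 - E)))
        (1 : Matrix Unit Unit F) := by
    simp [parabolicMat, fromBlocks_multiply, fromBlocks_mul_fromRows, fromCols_mul_fromBlocks]
  rw [hM]
  simp only [parabolicMat, fromBlocks_inj, fromRows_inj.eq_iff, fromCols_inj.eq_iff]
  constructor
  · rintro ⟨a', b', d', c', h', ⟨-, -, h1, -⟩, ⟨-, h2⟩, ⟨h3, -⟩, -⟩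
    -- The lower left block is a sum of three terms lying in different Peirce components of the
    -- idempotent `E`; compressing on both sides isolates each of them.
    have hl := congrArg (E * · * (1 - E)) h1
    have hm := congrArg (E * · * E) h1
    have hr := congrArg ((1 - E) * · * E) h1
    have key : ∀ x y z w : Matrix (Fin n) (Fin n) F, x * (y * z * w) = (x * y) * z * w := by
      intros; simp only [Matrix.mul_assoc]
    have key2 : ∀ x y z w : Matrix (Fin n) (Fin n) F, (x * y * z) * w = x * y * (z * w) := by
      intros; simp only [Matrix.mul_assoc]
    simp only [Matrix.add_mul, Matrix.mul_add, key, key2, hE, hE', hE'', hE3, Matrix.zero_mul,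
      Matrix.mul_zero, add_zero, zero_add] at hl hm hr
    exact ⟨hl, hm, hr, h3, h2⟩
  · rintro ⟨h1, h2, h3, h4, h5⟩
    refine ⟨_, _, _, _, _, ⟨rfl, rfl, ?_, rfl⟩, ⟨rfl, h5⟩, ⟨h4, rfl⟩, trivial⟩
    rw [h1, Matrix.add_mul, h2, h3]
    simp

end Parabolic

/-! ### Fibre counts on finite types. -/

section Counting

theorem card_subtype_prod {α β : Type*} [Fintype α] [Finite β] (P : α × β → Prop) :
    Nat.card {p // P p} = ∑ a, Nat.card {b // P (a, b)} := by
  rw [← Nat.card_sigma]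
  exact Nat.card_congr
    { toFun := fun p => ⟨p.1.1, p.1.2, p.2⟩
      invFun := fun p => ⟨(p.1, p.2.1), p.2.2⟩
      left_inv := fun _ => rfl
      right_inv := fun _ => rfl }

/-- The maps `τ c` carry fibres bijectively onto fibres, so all fibres have the same size. -/
theorem card_fiber_of_translation {α F : Type*} [Finite α] [AddGroup F] [Finite F] (f : α → F)
    (τ : F → α → α) (hτ : ∀ c a, f (τ c a) = f a + c) (hinv : ∀ c a, τ (-c) (τ c a) = a) (c : F) :
    Nat.card F * Nat.card {a // f a = c} = Nat.card α := by
  have key : ∀ b, Nat.card {a // f a = b} = Nat.card {a // f a = c} := by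
    intro b
    refine Nat.card_congr
      { toFun := fun a => ⟨τ (-b + c) a.1, by rw [hτ, a.2]; simp⟩
        invFun := fun a => ⟨τ (-(-b + c)) a.1, by rw [hτ, a.2]; simp⟩
        left_inv := fun a => Subtype.ext (hinv _ _)
        right_inv := fun a => Subtype.ext (by simpa using hinv (-(-b + c)) a.1) }
  exact (card_eq_mul_of_card_fiber f _ key).symm

end Counting

/-! ### The number of antisymmetric matrices. -/

section Antisymm

variable {F : Type*} [Field F]

/-- Block decomposition of antisymmetric matrices. -/
def antisymmSumEquiv (m k : Type*) :
    Antisymm F (m ⊕ k) ≃ Antisymm F m × Antisymm F k × Matrix m k F where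
  toFun C := (⟨C.1.toBlocks₁₁, by ext i j; exact congrFun (congrFun C.2 (.inl i)) (.inl j)⟩,
    ⟨C.1.toBlocks₂₂, by ext i j; exact congrFun (congrFun C.2 (.inr i)) (.inr j)⟩,
    C.1.toBlocks₁₂)
  invFun p := ⟨fromBlocks p.1.1 p.2.2 (-p.2.2ᵀ) p.2.1.1, by
    rw [fromBlocks_transpose, p.1.2, p.2.1.2, fromBlocks_neg]; simp⟩
  left_inv C := by
    have h : -C.1.toBlocks₁₂ᵀ = C.1.toBlocks₂₁ := by
      ext i j
      exact neg_eq_iff_eq_neg.2 (congrFun (congrFun C.2 (.inr i)) (.inl j))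
    apply Subtype.ext
    conv_rhs => rw [← fromBlocks_toBlocks C.1, ← h]
  right_inv p := by simp

omit [Field F] in
theorem card_matrix (m k : Type*) [Finite m] [Finite k] :
    Nat.card (Matrix m k F) = Nat.card F ^ (Nat.card m * Nat.card k) := by
  rw [Matrix, Nat.card_fun, Nat.card_fun, ← pow_mul, mul_comm]

theorem card_antisymm_sum (m k : Type*) [Finite m] [Finite k] :
    Nat.card (Antisymm F (m ⊕ k)) = Nat.card (Antisymm F m) * Nat.card (Antisymm F k) *
      Nat.card F ^ (Nat.card m * Nat.card k) := by
  rw [Nat.card_congr (antisymmSumEquiv m k), Nat.card_prod, Nat.card_prod, card_matrix, mul_assoc]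

theorem card_antisymm_sum_toBlocks₁₁_eq_zero (m k : Type*) [Finite m] [Finite k] :
    Nat.card {C : Antisymm F (m ⊕ k) // C.1.toBlocks₁₁ = 0} = Nat.card (Antisymm F k) *
      Nat.card F ^ (Nat.card m * Nat.card k) := by
  rw [← card_matrix, ← Nat.card_prod]
  refine Nat.card_congr
    { toFun := fun C => (antisymmSumEquiv m k C.1).2
      invFun := fun p => ⟨(antisymmSumEquiv m k).symm (⟨0, by simp⟩, p), rfl⟩
      left_inv := fun C => Subtype.ext ?_
      right_inv := fun p => by simp }
  rw [Equiv.symm_apply_eq]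
  exact Prod.ext (Subtype.ext C.2.symm) rfl

theorem card_antisymm_congr {m k : Type*} (e : m ≃ k) :
    Nat.card (Antisymm F m) = Nat.card (Antisymm F k) :=
  Nat.card_congr <| (reindex e e).subtypeEquiv fun C => by
    exact ((reindex e e).injective.eq_iff (a := Cᵀ) (b := -C)).symm

theorem card_antisymm_unit (h2 : (2 : F) ≠ 0) : Nat.card (Antisymm F Unit) = 1 := by
  rw [Nat.card_eq_one_iff_unique]
  refine ⟨⟨fun C D => Subtype.ext ?_⟩, ⟨⟨0, by simp⟩⟩⟩
  have key : ∀ C : Antisymm F Unit, C.1 = 0 := by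
    intro C
    ext i j
    have h : C.1 j i = - C.1 i j := congrFun (congrFun C.2 i) j
    obtain rfl : i = j := rfl
    have : (2 : F) * C.1 i i = 0 := by linear_combination h
    simpa [h2] using this
  rw [key, key]

theorem card_antisymm_fin (h2 : (2 : F) ≠ 0) (n : ℕ) :
    Nat.card (Antisymm F (Fin n)) = Nat.card F ^ (n * (n - 1) / 2) := by
  -- As a binomial coefficient the exponent grows by Pascal's rule, matching the `n` new entries
  -- when one row and column are added.
  rw [← Nat.choose_two_right]
  induction n with
  | zero =>
    simp only [Nat.choose_zero_succ, pow_zero]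
    rw [Nat.card_eq_one_iff_unique]
    exact ⟨⟨fun C D => Subtype.ext (by ext i; exact i.elim0)⟩, ⟨⟨0, by simp⟩⟩⟩
  | succ n ih =>
    rw [card_antisymm_congr ((finSumFinEquiv.symm).trans (Equiv.sumCongr (Equiv.refl (Fin n))
        (Equiv.ofUnique (Fin 1) Unit))), card_antisymm_sum, card_antisymm_unit h2, ih,
      Nat.choose_succ_succ' n 1]
    simp [pow_add, mul_comm]

end Antisymm

/-! ### The trace pairing with antisymmetric matrices. -/

section AntisymmTrace

variable {F : Type*} [Field F] {ι : Type*} [Fintype ι]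

/-- Transposing the product reverses the sign of its trace. -/
theorem trace_mul_antisymm_eq_zero (h2 : (2 : F) ≠ 0) {M : Matrix ι ι F} (hM : Mᵀ = M)
    (C : Antisymm F ι) : (M * C.1).trace = 0 := by
  have h : (M * C.1).trace = -(M * C.1).trace := by
    conv_lhs => rw [← trace_transpose, transpose_mul, C.2, hM, Matrix.neg_mul, trace_neg,
      trace_mul_comm]
  have : (2 : F) * (M * C.1).trace = 0 := by linear_combination h
  simpa [h2] using this

theorem exists_trace_mul_antisymm_eq_one [DecidableEq ι] {M : Matrix ι ι F} (hM : Mᵀ ≠ M) :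
    ∃ C : Antisymm F ι, (M * C.1).trace = 1 := by
  obtain ⟨i, j, hij⟩ : ∃ i j, M j i ≠ M i j := by
    by_contra! h
    exact hM (by ext i j; exact h i j)
  have hne : M j i - M i j ≠ 0 := sub_ne_zero.2 hij
  refine ⟨⟨(M j i - M i j)⁻¹ • (single i j 1 - single j i 1), ?_⟩, ?_⟩
  · rw [transpose_smul, transpose_sub, transpose_single, transpose_single, ← smul_neg, neg_sub]
  · simp [Matrix.mul_sub, trace_mul_single, hne]

/-- For non-symmetric `M` the functional `C ↦ Tr(MC)` takes the value 1 at some `C₀`; adding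
multiples of `C₀` shifts its values, so it is equidistributed. -/
theorem card_trace_mul_antisymm [Finite F] [DecidableEq ι] {M : Matrix ι ι F} (hM : Mᵀ ≠ M)
    (c : F) :
    Nat.card F * Nat.card {C : Antisymm F ι // (M * C.1).trace = c} = Nat.card (Antisymm F ι) := by
  obtain ⟨C₀, hC₀⟩ := exists_trace_mul_antisymm_eq_one hM
  refine card_fiber_of_translation _
    (fun c C => (⟨C.1 + c • C₀.1, by
      rw [transpose_add, transpose_smul, C.2, C₀.2, smul_neg, neg_add]⟩ : Antisymm F ι)) ?_ ?_ c
  · intro c C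
    simp [Matrix.mul_add, hC₀]
  · intro c C
    apply Subtype.ext
    simp

end AntisymmTrace

/-! ### Block lower triangular invertible matrices. -/

section LowerTriangular

variable {F : Type*} [Field F] {m k : Type*} [Fintype m] [DecidableEq m] [Fintype k]
  [DecidableEq k]

/-- The lower block triangular matrix with the given blocks. -/
def lowerGL (S : GL m F) (T : GL k F) (X : Matrix k m F) : GL (m ⊕ k) F where
  val := fromBlocks (S : Matrix m m F) 0 X (T : Matrix k k F)
  inv := fromBlocks ((S⁻¹ : GL m F) : Matrix m m F) 0
    (-(((T⁻¹ : GL k F) : Matrix k k F) * X * ((S⁻¹ : GL m F) : Matrix m m F)))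
    ((T⁻¹ : GL k F) : Matrix k k F)
  val_inv := by
    have h : (T : Matrix k k F) * (((T⁻¹ : GL k F) : Matrix k k F) * X *
        ((S⁻¹ : GL m F) : Matrix m m F)) = X * ((S⁻¹ : GL m F) : Matrix m m F) := by
      rw [← Matrix.mul_assoc, ← Matrix.mul_assoc, Units.mul_inv, Matrix.one_mul]
    rw [fromBlocks_multiply, Matrix.mul_neg (T : Matrix k k F), h, Units.mul_inv, Units.mul_inv]
    simp
  inv_val := by
    rw [fromBlocks_multiply, Matrix.neg_mul, Matrix.mul_assoc _ _ (S : Matrix m m F),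
      Units.inv_mul, Units.inv_mul]
    simp

theorem coe_lowerGL (S : GL m F) (T : GL k F) (X : Matrix k m F) :
    (lowerGL S T X : Matrix (m ⊕ k) (m ⊕ k) F) = fromBlocks (S : Matrix m m F) 0 X
      (T : Matrix k k F) := rfl

theorem coe_lowerGL_inv (S : GL m F) (T : GL k F) (X : Matrix k m F) :
    ((lowerGL S T X)⁻¹ : GL (m ⊕ k) F).val = fromBlocks ((S⁻¹ : GL m F) : Matrix m m F) 0
    (-(((T⁻¹ : GL k F) : Matrix k k F) * X * ((S⁻¹ : GL m F) : Matrix m m F)))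
    ((T⁻¹ : GL k F) : Matrix k k F) := rfl

variable (F m k) in
/-- Lower block triangular invertible matrices. -/
noncomputable def lowerGLEquiv :
    GL m F × GL k F × Matrix k m F ≃ {A : GL (m ⊕ k) F // A.val.toBlocks₁₂ = 0} :=
  Equiv.ofBijective (fun p => ⟨lowerGL p.1 p.2.1 p.2.2, by simp [coe_lowerGL]⟩) <| by
    constructor
    · rintro ⟨S, T, X⟩ ⟨S', T', X'⟩ h
      have h1 := congrArg (fun A => (A.1 : GL (m ⊕ k) F).val) h
      simp only [coe_lowerGL, fromBlocks_inj] at h1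
      obtain ⟨h1, -, h2, h3⟩ := h1
      simp [Units.ext h1, h2, Units.ext h3]
    · rintro ⟨A, hA⟩
      have h1 : A.val = fromBlocks A.val.toBlocks₁₁ 0 A.val.toBlocks₂₁ A.val.toBlocks₂₂ := by
        conv_lhs => rw [← fromBlocks_toBlocks A.val, hA]
      have h2 := A.isUnit
      rw [h1, isUnit_fromBlocks_zero₁₂] at h2
      obtain ⟨⟨S, hS⟩, ⟨T, hT⟩⟩ := h2
      refine ⟨(S, T, A.val.toBlocks₂₁), Subtype.ext (Units.ext ?_)⟩
      rw [coe_lowerGL, hS, hT]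
      exact h1.symm

theorem lowerGLEquiv_apply (p : GL m F × GL k F × Matrix k m F) :
    (lowerGLEquiv F m k p).1 = lowerGL p.1 p.2.1 p.2.2 := rfl

end LowerTriangular

/-! ### Trace and stabiliser conditions, and their invariance under reindexing. -/

section Predicates

variable {F : Type*} [Field F] {ι κ : Type*} [Fintype ι] [DecidableEq ι] [Fintype κ]
  [DecidableEq κ]

/-- The condition `Tr (w σ) = β` in terms of the parameters of `w`, where the idempotent `E`
describes `σ`. -/
def TraceEq (E : Matrix ι ι F) (β : F) (p : ParabolicParam F ι) : Prop :=
  (p.1.val * (1 - E)).trace + ((p.1⁻¹).val * (1 - E)).trace + (E * p.1.val * p.2.1.1).trace +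
    p.2.2 ⬝ᵥ (E * p.1.val) *ᵥ p.2.2 + 1 = β

/-- The condition `σ w σ ∈ Q` in terms of the parameters of `w`, where the idempotent `E`
describes `σ`. -/
def IsStab (E : Matrix ι ι F) (p : ParabolicParam F ι) : Prop :=
  E * p.1.val * (1 - E) = 0 ∧ E * (p.1.val * (p.2.1.1 + vecMulVec p.2.2 p.2.2)) * E = 0 ∧
    (1 - E) * (p.1⁻¹).valᵀ * E = 0 ∧ p.2.2 ᵥ* E = 0 ∧ (E * p.1.val) *ᵥ p.2.2 = 0

/-- Reindexing an invertible matrix. -/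
def reindexGL (e : κ ≃ ι) : GL ι F ≃ GL κ F :=
  (Units.mapEquiv (reindexAlgEquiv F F e.symm).toMulEquiv).toEquiv

theorem coe_reindexGL (e : κ ≃ ι) (A : GL ι F) : (reindexGL e A).val = A.val.submatrix e e := rfl

theorem coe_reindexGL_inv (e : κ ≃ ι) (A : GL ι F) :
    ((reindexGL e A)⁻¹).val = (A⁻¹).val.submatrix e e := rfl

/-- Reindexing an antisymmetric matrix. -/
def reindexAntisymm (e : κ ≃ ι) : Antisymm F ι ≃ Antisymm F κ :=
  (reindex e.symm e.symm).subtypeEquiv fun C =>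
    ((reindex e.symm e.symm).injective.eq_iff (a := Cᵀ) (b := -C)).symm

theorem coe_reindexAntisymm (e : κ ≃ ι) (C : Antisymm F ι) :
    (reindexAntisymm e C).1 = C.1.submatrix e e := rfl

/-- Reindexing parameters. -/
def reindexParam (e : κ ≃ ι) : ParabolicParam F ι ≃ ParabolicParam F κ :=
  Equiv.prodCongr (reindexGL e) (Equiv.prodCongr (reindexAntisymm e) (e.symm.arrowCongr (.refl F)))

theorem reindexParam_apply (e : κ ≃ ι) (p : ParabolicParam F ι) :
    reindexParam e p = (reindexGL e p.1, reindexAntisymm e p.2.1, p.2.2 ∘ e) := rfl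

theorem trace_submatrix_equiv (e : κ ≃ ι) (M : Matrix ι ι F) :
    (M.submatrix e e).trace = M.trace := by
  simp only [Matrix.trace, diag_apply, submatrix_apply]
  exact e.sum_comp fun i => M i i

theorem submatrix_mulVec_comp (e : κ ≃ ι) (M : Matrix ι ι F) (v : ι → F) :
    M.submatrix e e *ᵥ (v ∘ e) = (M *ᵥ v) ∘ e := by
  rw [submatrix_mulVec_equiv]
  congr 2
  ext
  simp

theorem submatrix_vecMul_comp (e : κ ≃ ι) (M : Matrix ι ι F) (v : ι → F) :
    (v ∘ e) ᵥ* M.submatrix e e = (v ᵥ* M) ∘ e := by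
  rw [submatrix_vecMul_equiv]
  congr 2
  ext
  simp

theorem one_sub_submatrix (e : κ ≃ ι) (E : Matrix ι ι F) :
    1 - E.submatrix e e = (1 - E).submatrix e e := by
  rw [← submatrix_one_equiv e]; rfl

theorem submatrix_equiv_eq_zero_iff (e : κ ≃ ι) (M : Matrix ι ι F) :
    M.submatrix e e = 0 ↔ M = 0 :=
  (reindex e.symm e.symm).injective.eq_iff (a := M) (b := 0)

theorem comp_equiv_eq_zero_iff (e : κ ≃ ι) (v : ι → F) : v ∘ e = 0 ↔ v = 0 :=
  e.surjective.injective_comp_right.eq_iff (a := v) (b := 0)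

theorem traceEq_reindex (e : κ ≃ ι) (E : Matrix ι ι F) (β : F) (p : ParabolicParam F ι) :
    TraceEq (E.submatrix e e) β (reindexParam e p) ↔ TraceEq E β p := by
  simp only [TraceEq, reindexParam_apply, coe_reindexGL, coe_reindexGL_inv, coe_reindexAntisymm,
    one_sub_submatrix, submatrix_mul_equiv, trace_submatrix_equiv, submatrix_mulVec_comp,
    comp_equiv_dotProduct_comp_equiv]

theorem isStab_reindex (e : κ ≃ ι) (E : Matrix ι ι F) (p : ParabolicParam F ι) :
    IsStab (E.submatrix e e) (reindexParam e p) ↔ IsStab E p := by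
  have h (v : ι → F) : vecMulVec (v ∘ e) (v ∘ e) = (vecMulVec v v).submatrix e e := rfl
  have hadd (M N : Matrix ι ι F) : M.submatrix e e + N.submatrix e e = (M + N).submatrix e e := rfl
  simp only [IsStab, reindexParam_apply, coe_reindexGL, coe_reindexGL_inv, coe_reindexAntisymm, h,
    hadd, one_sub_submatrix, submatrix_mul_equiv, submatrix_mulVec_comp, submatrix_vecMul_comp,
    transpose_submatrix, submatrix_equiv_eq_zero_iff, comp_equiv_eq_zero_iff]

end Predicates

/-! ### From the orthogonal group to parameters. -/

section Translation

variable {n : ℕ} {F : Type*} [Field F]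

theorem trace_mat_mul_sigma_iff (p : QParam n F) (r : ℕ) (β : F) :
    (p.mat * toMat (sigma n F r)).trace = β ↔ TraceEq (topId n F r) β p := by
  rw [QParam.mat, leviMat_mul_unipMat, trace_parabolicMat_mul_sigma, TraceEq]
  have h1 : ((p.1⁻¹).valᵀ * (1 - topId n F r)).trace = ((p.1⁻¹).val * (1 - topId n F r)).trace := by
    rw [← trace_transpose, transpose_mul, transpose_transpose, transpose_sub, transpose_one,
      topId_transpose, trace_mul_comm]
  -- Substituting `B = C + v ᵗv` splits this trace into a linear form in `C` and a quadratic form in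
  -- `v`.
  have h2 : (p.1.val * p.upper * topId n F r).trace = (topId n F r * p.1.val * p.2.1.1).trace +
      p.2.2 ⬝ᵥ (topId n F r * p.1.val) *ᵥ p.2.2 := by
    rw [trace_mul_comm, ← Matrix.mul_assoc, QParam.upper, Matrix.mul_add, trace_add,
      mul_vecMulVec, trace_vecMulVec, dotProduct_comm]
  rw [h1, h2]
  constructor <;> intro h <;> linear_combination h

theorem sigma_conj_mem_iff (w : OGroup n F) (p : QParam n F) (hp : toMat w = p.mat) (r : ℕ) :
    (sigma n F r)⁻¹ * w * sigma n F r ∈ QSubgroup n F ↔ IsStab (topId n F r) p := by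
  change _ ∈ Q n F ↔ _
  rw [mem_Q_iff, sigma_inv, toMat_mul, toMat_mul, hp, QParam.mat, leviMat_mul_unipMat,
    sigma_conj_parabolicMat_iff, IsStab]
  have h1 : replicateRow Unit p.2.2 * topId n F r = 0 ↔ p.2.2 ᵥ* topId n F r = 0 := by
    rw [← replicateRow_vecMul]
    exact (replicateRow_injective (ι := Unit)).eq_iff (a := p.2.2 ᵥ* topId n F r) (b := 0)
  have h2 : topId n F r * -(p.1.val * (replicateRow Unit p.2.2)ᵀ) = 0 ↔
      (topId n F r * p.1.val) *ᵥ p.2.2 = 0 := by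
    rw [Matrix.mul_neg, neg_eq_zero, ← Matrix.mul_assoc, transpose_replicateRow,
      ← replicateCol_mulVec]
    exact (replicateCol_injective (ι := Unit)).eq_iff (a := (topId n F r * p.1.val) *ᵥ p.2.2)
      (b := 0)
  rw [h1, h2]
  rfl

variable [Finite F]

/-- The fundamental identity for the trace distribution on `Q σ_r Q`. -/
theorem N_doubleCoset_mul_card (h3 : (3 : F) = 0) (r : ℕ) (β : F) :
    N (DoubleCoset.doubleCoset (sigma n F r) (Q n F) (Q n F)) β *
      Nat.card {p : QParam n F // IsStab (topId n F r) p} =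
    Nat.card (QParam n F) * Nat.card {p : QParam n F // TraceEq (topId n F r) β p} := by
  have : Finite (GL (Idx n) F) := inferInstance
  have h := card_doubleCoset_mul_card (QSubgroup n F) (sigma n F r)
    (fun w => (toMat w).trace = β) (by
      intro a b hab
      rwa [toMat_mul, trace_mul_comm] at hab)
  have h1 : Nat.card {x : QSubgroup n F // (sigma n F r)⁻¹ * x * sigma n F r ∈ QSubgroup n F} =
      Nat.card {p : QParam n F // IsStab (topId n F r) p} :=
    (Nat.card_congr ((QParam.equiv h3).subtypeEquiv fun p =>
      (sigma_conj_mem_iff _ p (QParam.toMat_equiv h3 p) r).symm)).symm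
  have h2 : Nat.card {x : QSubgroup n F // (toMat (x * sigma n F r : OGroup n F)).trace = β} =
      Nat.card {p : QParam n F // TraceEq (topId n F r) β p} :=
    (Nat.card_congr ((QParam.equiv h3).subtypeEquiv fun p => by
      rw [toMat_mul, QParam.toMat_equiv, trace_mat_mul_sigma_iff])).symm
  rw [h1, h2, ← Nat.card_congr (QParam.equiv h3)] at h
  exact h

end Translation

/-! ### The stabiliser in block coordinates, with `Fin (r + k)` split as a sum. -/

section Blocks

variable {F : Type*} [Field F] {m k : Type*} [Fintype m] [DecidableEq m] [Fintype k]
  [DecidableEq k]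

theorem topId_submatrix (r k : ℕ) :
    (topId (r + k) F r).submatrix finSumFinEquiv finSumFinEquiv =
      (fromBlocks 1 0 0 0 : Matrix (Fin r ⊕ Fin k) (Fin r ⊕ Fin k) F) := by
  ext i j
  rcases i with i | i <;> rcases j with j | j <;>
    simp [topId, diagonal_apply, Matrix.one_apply, Fin.ext_iff]
  omega

theorem card_isStab_topId (r k : ℕ) :
    Nat.card {p : QParam (r + k) F // IsStab (topId (r + k) F r) p} =
      Nat.card {p : ParabolicParam F (Fin r ⊕ Fin k) // IsStab (fromBlocks 1 0 0 0) p} :=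
  Nat.card_congr ((reindexParam finSumFinEquiv).subtypeEquiv fun p => by
    rw [← topId_submatrix, isStab_reindex])

theorem card_traceEq_topId (r k : ℕ) (β : F) :
    Nat.card {p : QParam (r + k) F // TraceEq (topId (r + k) F r) β p} =
      Nat.card {p : ParabolicParam F (Fin r ⊕ Fin k) // TraceEq (fromBlocks 1 0 0 0) β p} :=
  Nat.card_congr ((reindexParam finSumFinEquiv).subtypeEquiv fun p => by
    rw [← topId_submatrix, traceEq_reindex])

theorem one_sub_fromBlocks :
    (1 - fromBlocks 1 0 0 0 : Matrix (m ⊕ k) (m ⊕ k) F) = fromBlocks 0 0 0 1 := by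
  rw [← fromBlocks_one, sub_eq_add_neg, fromBlocks_neg, fromBlocks_add]; simp

theorem fromBlocks_one_mul (M : Matrix (m ⊕ k) (m ⊕ k) F) :
    fromBlocks 1 0 0 0 * M = fromBlocks M.toBlocks₁₁ M.toBlocks₁₂ 0 0 := by
  conv_lhs => rw [← fromBlocks_toBlocks M, fromBlocks_multiply]
  simp

theorem fromBlocks_mul_mul_fromBlocks (M : Matrix (m ⊕ k) (m ⊕ k) F) :
    fromBlocks 1 0 0 0 * M * fromBlocks 0 0 0 1 = fromBlocks 0 M.toBlocks₁₂ 0 0 := by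
  rw [fromBlocks_one_mul, fromBlocks_multiply]
  simp

/-- The first condition makes `A` block lower triangular with invertible corner `S`. Once `v`
vanishes on the first block, so does the corner of `v ᵗv`, and cancelling `S` leaves only the corner
of `C`; the other two conditions are then automatic. -/
theorem isStab_iff (p : ParabolicParam F (m ⊕ k)) :
    IsStab (fromBlocks 1 0 0 0) p ↔ p.1.val.toBlocks₁₂ = 0 ∧ p.2.1.1.toBlocks₁₁ = 0 ∧
      p.2.2 ∘ Sum.inl = 0 := by
  obtain ⟨A, C, v⟩ := p
  have h0 : IsStab (fromBlocks 1 0 0 0) (A, C, v) → A.val.toBlocks₁₂ = 0 := by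
    intro h
    have h1 := h.1
    rw [one_sub_fromBlocks, fromBlocks_mul_mul_fromBlocks, ← fromBlocks_zero, fromBlocks_inj] at h1
    exact h1.2.1
  suffices hmain : A.val.toBlocks₁₂ = 0 → (IsStab (fromBlocks 1 0 0 0) (A, C, v) ↔
      C.1.toBlocks₁₁ = 0 ∧ v ∘ Sum.inl = 0) from
    ⟨fun h => ⟨h0 h, (hmain (h0 h)).1 h⟩, fun h => (hmain h.1).2 h.2⟩
  intro hA
  obtain ⟨⟨S, T, X⟩, hp⟩ := (lowerGLEquiv F m k).surjective ⟨A, hA⟩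
  obtain rfl : lowerGL S T X = A := congrArg Subtype.val hp
  have hE : v ᵥ* (fromBlocks 1 0 0 0 : Matrix (m ⊕ k) (m ⊕ k) F) = 0 ↔ v ∘ Sum.inl = 0 := by
    rw [vecMul_fromBlocks]
    simp only [vecMul_one, vecMul_zero, add_zero]
    constructor
    · intro h; ext i; exact congrFun h (Sum.inl i)
    · intro h; rw [h]; ext i; rcases i <;> rfl
  simp only [IsStab]
  rw [hE, one_sub_fromBlocks, coe_lowerGL, coe_lowerGL_inv]
  constructor
  · rintro ⟨-, h, -, hv, -⟩
    refine ⟨?_, hv⟩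
    have hvv : (vecMulVec v v).toBlocks₁₁ = 0 := by
      ext i j
      have : v (Sum.inl i) = 0 := congrFun hv i
      simp [toBlocks₁₁, vecMulVec_apply, this]
    rw [fromBlocks_one_mul, fromBlocks_multiply, ← fromBlocks_zero, fromBlocks_inj] at h
    have h1 := h.1
    rw [← fromBlocks_toBlocks (C.1 + vecMulVec v v), fromBlocks_multiply] at h1
    simp only [toBlocks_fromBlocks₁₁, Matrix.zero_mul, Matrix.mul_zero, add_zero, Matrix.mul_one]
      at h1
    have h2 : (C.1 + vecMulVec v v).toBlocks₁₁ = C.1.toBlocks₁₁ + (vecMulVec v v).toBlocks₁₁ := rfl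
    rw [h2, hvv, add_zero] at h1
    have := congrArg ((S⁻¹).val * ·) h1
    simpa only [← Matrix.mul_assoc, Units.inv_mul, Matrix.one_mul, Matrix.mul_zero] using this
  · rintro ⟨hC1, hv⟩
    have hvv : (vecMulVec v v).toBlocks₁₁ = 0 := by
      ext i j
      have : v (Sum.inl i) = 0 := congrFun hv i
      simp [toBlocks₁₁, vecMulVec_apply, this]
    have h2 : (C.1 + vecMulVec v v).toBlocks₁₁ = 0 := by
      change C.1.toBlocks₁₁ + (vecMulVec v v).toBlocks₁₁ = 0
      rw [hC1, hvv, add_zero]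
    refine ⟨?_, ?_, ?_, hv, ?_⟩
    · rw [fromBlocks_mul_mul_fromBlocks, toBlocks_fromBlocks₁₂, fromBlocks_zero]
    · rw [← fromBlocks_toBlocks (C.1 + vecMulVec v v), h2]
      simp [fromBlocks_multiply]
    · simp [fromBlocks_transpose, fromBlocks_multiply]
    · rw [fromBlocks_one_mul, fromBlocks_mulVec]
      simp only [toBlocks_fromBlocks₁₁, toBlocks_fromBlocks₁₂, zero_mulVec, add_zero]
      rw [hv, mulVec_zero]
      ext i; rcases i <;> rfl

theorem card_isStab [Finite F] :
    Nat.card {p : ParabolicParam F (m ⊕ k) // IsStab (fromBlocks 1 0 0 0) p} =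
      (Nat.card (GL m F) * Nat.card (GL k F) * Nat.card F ^ (Nat.card k * Nat.card m)) *
      (Nat.card (Antisymm F k) * Nat.card F ^ (Nat.card m * Nat.card k)) *
      Nat.card F ^ Nat.card k := by
  have h1 : Nat.card {v : m ⊕ k → F // v ∘ Sum.inl = 0} = Nat.card F ^ Nat.card k := by
    rw [← Nat.card_fun]
    refine Nat.card_congr
      { toFun := fun v => v.1 ∘ Sum.inr
        invFun := fun v => ⟨Sum.elim 0 v, by simp⟩
        left_inv := fun v => Subtype.ext ?_
        right_inv := fun v => by simp }
    conv_rhs => rw [← Sum.elim_comp_inl_inr v.1, v.2]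
  have h2 : Nat.card {A : GL (m ⊕ k) F // A.val.toBlocks₁₂ = 0} =
      Nat.card (GL m F) * Nat.card (GL k F) * Nat.card F ^ (Nat.card k * Nat.card m) := by
    rw [← Nat.card_congr (lowerGLEquiv F m k), Nat.card_prod, Nat.card_prod, card_matrix, mul_assoc]
  rw [← h1, ← h2, ← card_antisymm_sum_toBlocks₁₁_eq_zero, mul_assoc, ← Nat.card_prod,
    ← Nat.card_prod]
  exact Nat.card_congr
    { toFun := fun p => (⟨p.1.1, ((isStab_iff p.1).1 p.2).1⟩,
        ⟨p.1.2.1, ((isStab_iff p.1).1 p.2).2.1⟩, ⟨p.1.2.2, ((isStab_iff p.1).1 p.2).2.2⟩)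
      invFun := fun p => ⟨(p.1.1, p.2.1.1, p.2.2.1), (isStab_iff _).2 ⟨p.1.2, p.2.1.2, p.2.2.2⟩⟩
      left_inv := fun _ => rfl
      right_inv := fun _ => rfl }

end Blocks

/-! ### The trace distribution on `Qσ_r`. -/

section TraceCount

variable {F : Type*} [Field F] {ι : Type*} [Fintype ι] [DecidableEq ι]

/-- The contribution to the trace not involving the antisymmetric parameter. -/
def diagonalTrace (E : Matrix ι ι F) (x : GL ι F × (ι → F)) : F :=
  (x.1.val * (1 - E)).trace + ((x.1⁻¹).val * (1 - E)).trace + x.2 ⬝ᵥ (E * x.1.val) *ᵥ x.2 + 1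

theorem card_eq_sum_ite {α : Type*} [Fintype α] (P : α → Prop) [DecidablePred P] :
    Nat.card {a // P a} = ∑ a, if P a then 1 else 0 := by
  rw [Nat.card_eq_fintype_card, Fintype.card_subtype, Finset.card_filter]

/-- For fixed `(A, v)` the condition on `C` prescribes a value of `C ↦ Tr(EAC)`. If `EA` is not
symmetric, a proportion `1/q` of all `C` qualifies; if it is symmetric, the functional is zero and
either every `C` or none does. -/
theorem card_traceEq [Finite F] (h2 : (2 : F) ≠ 0) (E : Matrix ι ι F) (β : F) :
    Nat.card F * Nat.card {p : ParabolicParam F ι // TraceEq E β p} =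
      Nat.card (Antisymm F ι) *
        (Nat.card {x : GL ι F × (ι → F) // (E * x.1.val)ᵀ ≠ E * x.1.val} +
          Nat.card F * Nat.card {x : GL ι F × (ι → F) //
            (E * x.1.val)ᵀ = E * x.1.val ∧ diagonalTrace E x = β}) := by
  classical
  have := Fintype.ofFinite (GL ι F)
  have := Fintype.ofFinite F
  have e : Nat.card {p : ParabolicParam F ι // TraceEq E β p} =
      Nat.card {y : (GL ι F × (ι → F)) × Antisymm F ι //
        (E * y.1.1.val * y.2.1).trace = β - diagonalTrace E y.1} := by
    refine Nat.card_congr (Equiv.subtypeEquiv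
      { toFun := fun p => ((p.1, p.2.2), p.2.1)
        invFun := fun y => (y.1.1, y.2, y.1.2)
        left_inv := fun _ => rfl
        right_inv := fun _ => rfl } fun p => ?_)
    simp only [TraceEq, diagonalTrace, Equiv.coe_fn_mk]
    constructor <;> intro h <;> linear_combination h
  rw [e, card_subtype_prod, card_eq_sum_ite (α := GL ι F × (ι → F)),
    card_eq_sum_ite (α := GL ι F × (ι → F)), mul_add, Finset.mul_sum,
    Finset.mul_sum, Finset.mul_sum, Finset.mul_sum, ← Finset.sum_add_distrib]
  refine Finset.sum_congr rfl fun x _ => ?_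
  by_cases hx : (E * x.1.val)ᵀ = E * x.1.val
  · simp only [trace_mul_antisymm_eq_zero h2 hx]
    rw [if_neg (not_not.2 hx)]
    by_cases hβ : diagonalTrace E x = β
    · rw [if_pos ⟨hx, hβ⟩]
      simp [hβ, mul_comm]
    · have : ¬ (0 = β - diagonalTrace E x) := fun h => hβ (sub_eq_zero.1 h.symm).symm
      rw [if_neg fun h => hβ h.2]
      simp [this]
  · rw [if_pos hx, if_neg fun h => hx h.1]
    exact (card_trace_mul_antisymm hx (β - diagonalTrace E x)).trans (by simp)

theorem card_subtype_add_card_not {α : Type*} [Finite α] (P : α → Prop) :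
    Nat.card {a // P a} + Nat.card {a // ¬ P a} = Nat.card α := by
  classical
  rw [← Nat.card_sum, Nat.card_congr (Equiv.sumCompl P)]

variable (F) in
/-- Symmetric invertible matrices. -/
abbrev SymGL (m : Type*) [Fintype m] [DecidableEq m] : Type _ := {S : GL m F // S.valᵀ = S.val}

variable (F) in
/-- The number of pairs of an invertible symmetric matrix `S` and a vector `v` with `v S ᵗv = c`. -/
noncomputable def quadCount (m : Type*) [Fintype m] [DecidableEq m] (c : F) : ℕ :=
  Nat.card {y : SymGL F m × (m → F) // y.2 ⬝ᵥ y.1.1.val *ᵥ y.2 = c}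

variable (F) in
/-- The number of invertible `T` with `Tr T + Tr T⁻¹ = c`. -/
noncomputable def kloostermanCount (k : Type*) [Fintype k] [DecidableEq k] (c : F) : ℕ :=
  Nat.card {T : GL k F // T.val.trace + (T⁻¹).val.trace = c}

variable {m k : Type*} [Fintype m] [DecidableEq m] [Fintype k] [DecidableEq k]

/-- The lower rows of `EM` are zero, so symmetry also kills its upper right block. -/
theorem fromBlocks_one_mul_symm_iff (M : Matrix (m ⊕ k) (m ⊕ k) F) :
    (fromBlocks 1 0 0 0 * M)ᵀ = fromBlocks 1 0 0 0 * M ↔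
      M.toBlocks₁₂ = 0 ∧ M.toBlocks₁₁ᵀ = M.toBlocks₁₁ := by
  rw [fromBlocks_one_mul, fromBlocks_transpose, fromBlocks_inj]
  simp only [transpose_zero]
  constructor
  · rintro ⟨h1, h2, -⟩
    exact ⟨h2.symm, h1⟩
  · rintro ⟨h1, h2⟩
    exact ⟨h2, h1.symm, by simp [h1], trivial⟩

variable (F m k) in
/-- Pairs of an invertible matrix with symmetric upper part and a vector. -/
noncomputable def symmetricUpperEquiv :
    ((SymGL F m × (m → F)) × GL k F) × Matrix k m F × (k → F) ≃
      {x : GL (m ⊕ k) F × (m ⊕ k → F) // (fromBlocks 1 0 0 0 * x.1.val)ᵀ =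
        fromBlocks 1 0 0 0 * x.1.val} where
  toFun y := ⟨(lowerGL y.1.1.1.1 y.1.2 y.2.1, Sum.elim y.1.1.2 y.2.2), by
    rw [fromBlocks_one_mul_symm_iff]
    exact ⟨by simp [coe_lowerGL], by simp [coe_lowerGL, y.1.1.1.2]⟩⟩
  invFun x :=
    let h := (fromBlocks_one_mul_symm_iff _).1 x.2
    let p := (lowerGLEquiv F m k).symm ⟨x.1.1, h.1⟩
    (((⟨p.1, by
      have h1 : (lowerGL p.1 p.2.1 p.2.2) = x.1.1 :=
        congrArg Subtype.val ((lowerGLEquiv F m k).apply_symm_apply ⟨x.1.1, h.1⟩)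
      have h2 := h.2
      rw [← h1, coe_lowerGL] at h2
      simpa using h2⟩, x.1.2 ∘ Sum.inl), p.2.1), p.2.2, x.1.2 ∘ Sum.inr)
  left_inv y := by
    have : (lowerGLEquiv F m k).symm ⟨lowerGL y.1.1.1.1 y.1.2 y.2.1, by simp [coe_lowerGL]⟩ =
        (y.1.1.1.1, y.1.2, y.2.1) := by
      rw [Equiv.symm_apply_eq]; rfl
    simp [this]
  right_inv x := by
    have h := (fromBlocks_one_mul_symm_iff _).1 x.2
    have h1 := congrArg Subtype.val ((lowerGLEquiv F m k).apply_symm_apply ⟨x.1.1, h.1⟩)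
    rw [lowerGLEquiv_apply] at h1
    apply Subtype.ext
    exact Prod.ext h1 (Sum.elim_comp_inl_inr _)

theorem diagonalTrace_symmetricUpperEquiv
    (y : ((SymGL F m × (m → F)) × GL k F) × Matrix k m F × (k → F)) :
    diagonalTrace (fromBlocks 1 0 0 0) (symmetricUpperEquiv F m k y).1 =
      y.1.1.2 ⬝ᵥ y.1.1.1.1.val *ᵥ y.1.1.2 + (y.1.2.val.trace + (y.1.2⁻¹).val.trace) + 1 := by
  have h1 : (symmetricUpperEquiv F m k y).1 =
    (lowerGL y.1.1.1.1 y.1.2 y.2.1, Sum.elim y.1.1.2 y.2.2) := rfl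
  have ht (M : Matrix (m ⊕ k) (m ⊕ k) F) :
      (M * fromBlocks 0 0 0 1).trace = M.toBlocks₂₂.trace := by
    conv_lhs => rw [← fromBlocks_toBlocks M, fromBlocks_multiply]
    simp [Matrix.trace, Fintype.sum_sum_type]
  rw [h1, diagonalTrace, one_sub_fromBlocks, fromBlocks_one_mul]
  simp only [ht, coe_lowerGL, coe_lowerGL_inv, toBlocks_fromBlocks₂₂, toBlocks_fromBlocks₁₁,
    toBlocks_fromBlocks₁₂, fromBlocks_mulVec, dotProduct_block, Sum.elim_comp_inl,
    Sum.elim_comp_inr, zero_mulVec, add_zero, dotProduct_zero]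
  ring

variable [Finite F]

theorem card_symmetricUpper :
    Nat.card {x : GL (m ⊕ k) F × (m ⊕ k → F) // (fromBlocks 1 0 0 0 * x.1.val)ᵀ =
        fromBlocks 1 0 0 0 * x.1.val} =
      Nat.card (SymGL F m) * Nat.card F ^ Nat.card m * Nat.card (GL k F) *
        (Nat.card F ^ (Nat.card k * Nat.card m) * Nat.card F ^ Nat.card k) := by
  rw [← Nat.card_congr (symmetricUpperEquiv F m k)]
  simp only [Nat.card_prod, card_matrix, Nat.card_fun]

theorem card_symmetricUpper_diagonalTrace (β : F) :
    Nat.card {x : GL (m ⊕ k) F × (m ⊕ k → F) // (fromBlocks 1 0 0 0 * x.1.val)ᵀ =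
        fromBlocks 1 0 0 0 * x.1.val ∧ diagonalTrace (fromBlocks 1 0 0 0) x = β} =
      Nat.card {y : GL k F × (SymGL F m × (m → F)) //
        y.2.2 ⬝ᵥ y.2.1.1.val *ᵥ y.2.2 + (y.1.val.trace + (y.1⁻¹).val.trace) = β - 1} *
        (Nat.card F ^ (Nat.card k * Nat.card m) * Nat.card F ^ Nat.card k) := by
  rw [← card_matrix, ← Nat.card_fun, ← Nat.card_prod, ← Nat.card_prod]
  have e1 := Nat.card_congr (Equiv.subtypeSubtypeEquivSubtypeInter
    (fun x : GL (m ⊕ k) F × (m ⊕ k → F) => (fromBlocks 1 0 0 0 * x.1.val)ᵀ =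
        fromBlocks 1 0 0 0 * x.1.val) (fun x => diagonalTrace (fromBlocks 1 0 0 0) x = β))
  rw [← e1, ← Nat.card_congr ((symmetricUpperEquiv F m k).subtypeEquiv fun y => Iff.rfl)]
  refine Nat.card_congr
    { toFun := fun y => (⟨(y.1.1.2, y.1.1.1), ?_⟩, y.1.2)
      invFun := fun z => ⟨((z.1.1.2, z.1.1.1), z.2), ?_⟩
      left_inv := fun _ => rfl
      right_inv := fun _ => rfl }
  · have := y.2
    rw [diagonalTrace_symmetricUpperEquiv] at this
    exact eq_sub_of_add_eq this
  · rw [diagonalTrace_symmetricUpperEquiv]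
    exact add_eq_of_eq_sub z.1.2

/-- Scaling `S` by a unit scales the value of the form and keeps `S` symmetric and invertible. -/
theorem quadCount_eq_of_ne_zero {c : F} (hc : c ≠ 0) : quadCount F m c = quadCount F m 1 := by
  have key (u : Fˣ) (d : F) : ∀ y : SymGL F m × (m → F), y.2 ⬝ᵥ y.1.1.val *ᵥ y.2 = d →
      y.2 ⬝ᵥ (u • y.1.1).val *ᵥ y.2 = u * d := by
    intro y hy
    rw [Units.val_smul, smul_mulVec, dotProduct_smul, hy]
    rfl
  have hs (u : Fˣ) (S : SymGL F m) : (u • S.1).valᵀ = (u • S.1).val := by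
    rw [Units.val_smul, transpose_smul, S.2]
  let u := Units.mk0 c hc
  refine Nat.card_congr
    { toFun := fun y => ⟨(⟨u⁻¹ • y.1.1.1, hs _ _⟩, y.1.2), ?_⟩
      invFun := fun y => ⟨(⟨u • y.1.1.1, hs _ _⟩, y.1.2), ?_⟩
      left_inv := fun y => ?_
      right_inv := fun y => ?_ }
  · refine (key u⁻¹ _ _ y.2).trans ?_
    simp [u, hc]
  · refine (key u _ _ y.2).trans ?_
    simp [u]
  · simp
  · simp

/-- For given `T` the form must take the value `γ - Tr T - Tr T⁻¹`. It is zero exactly for the `T`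
counted by `kloostermanCount`, which contribute `quadCount F m 0`; all others contribute `quadCount
F m 1`. The additive form avoids subtraction in `ℕ`. -/
theorem card_quad_add_kloosterman (γ : F) :
    Nat.card {y : GL k F × (SymGL F m × (m → F)) //
        y.2.2 ⬝ᵥ y.2.1.1.val *ᵥ y.2.2 + (y.1.val.trace + (y.1⁻¹).val.trace) = γ} +
      quadCount F m 1 * kloostermanCount F k γ =
    quadCount F m 1 * Nat.card (GL k F) + quadCount F m 0 * kloostermanCount F k γ := by
  classical
  have := Fintype.ofFinite (GL k F)
  rw [card_subtype_prod, kloostermanCount, card_eq_sum_ite, Nat.card_eq_fintype_card,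
    Fintype.card_eq_sum_ones, Finset.mul_sum, Finset.mul_sum, Finset.mul_sum,
    ← Finset.sum_add_distrib, ← Finset.sum_add_distrib]
  refine Finset.sum_congr rfl fun T _ => ?_
  have hT : Nat.card {y : SymGL F m × (m → F) //
      y.2 ⬝ᵥ y.1.1.val *ᵥ y.2 + (T.val.trace + (T⁻¹).val.trace) = γ} =
      quadCount F m (γ - (T.val.trace + (T⁻¹).val.trace)) :=
    Nat.card_congr (Equiv.subtypeEquivRight fun _ => eq_sub_iff_add_eq.symm)
  refine (congrArg (· + _) hT).trans ?_
  by_cases h : T.val.trace + (T⁻¹).val.trace = γ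
  · rw [if_pos h, h, sub_self]; ring
  · rw [if_neg h, quadCount_eq_of_ne_zero (sub_ne_zero.2 (Ne.symm h))]; ring

end TraceCount

/-! ### Invertible symmetric matrices and values of their quadratic forms. -/

section Symmetric

variable {F : Type*} [Field F] {ι κ α : Type*} [Fintype ι] [DecidableEq ι] [Fintype κ]
  [DecidableEq κ] [Fintype α] [DecidableEq α]

theorem exists_GL_mulVec_single_eq (i : ι) {w : ι → F} (hw : w ≠ 0) :
    ∃ P : GL ι F, P.val *ᵥ Pi.single i 1 = w := by
  obtain ⟨j, hj⟩ := Function.ne_iff.1 hw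
  -- Replacing column `i` of the identity by `w ∘ e` gives determinant `w j ≠ 0`; permuting the rows
  -- by `e` then restores `w` as that column.
  let e := Equiv.swap i j
  have h1 : IsUnit ((1 : Matrix ι ι F).updateCol i (w ∘ e)) := by
    rw [isUnit_iff_isUnit_det, ← cramer_apply, cramer_one]
    simpa [e] using hj
  have h2 := (isUnit_submatrix_equiv e (Equiv.refl ι)).2 h1
  obtain ⟨P, hP⟩ := h2
  refine ⟨P, ?_⟩
  rw [hP, mulVec_single_one]
  ext k
  simp [e]

theorem eq_of_GL_invariant {β : Type*} {f : (ι → F) → β} (hf : ∀ (P : GL ι F) v, f (P.val *ᵥ v) = f v)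
    (i : ι) {w : ι → F} (hw : w ≠ 0) : f w = f (Pi.single i 1) := by
  obtain ⟨P, rfl⟩ := exists_GL_mulVec_single_eq i hw
  exact hf _ _

/-- Congruence transformation of matrices. -/
def congruence (P : GL ι F) : Matrix ι ι F ≃ Matrix ι ι F where
  toFun D := P.val * D * P.valᵀ
  invFun D := (P⁻¹).val * D * (P⁻¹).valᵀ
  left_inv D := by
    have : P.valᵀ * (P⁻¹).valᵀ = 1 := by rw [← transpose_mul, Units.inv_mul, transpose_one]
    simp only [Matrix.mul_assoc, this, Matrix.mul_one]
    rw [← Matrix.mul_assoc, Units.inv_mul, Matrix.one_mul]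
  right_inv D := by
    have : (P⁻¹).valᵀ * P.valᵀ = 1 := by rw [← transpose_mul, Units.mul_inv, transpose_one]
    simp only [Matrix.mul_assoc, this, Matrix.mul_one]
    rw [← Matrix.mul_assoc, Units.mul_inv, Matrix.one_mul]

theorem congruence_apply (P : GL ι F) (D : Matrix ι ι F) :
    congruence P D = P.val * D * P.valᵀ := rfl

theorem transpose_congruence_eq_iff (P : GL ι F) (D : Matrix ι ι F) :
    (congruence P D)ᵀ = congruence P D ↔ Dᵀ = D := by
  have : (congruence P D)ᵀ = congruence P Dᵀ := by
    simp [congruence_apply, transpose_mul, Matrix.mul_assoc]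
  rw [this, (congruence P).injective.eq_iff]

theorem isUnit_transpose_val (P : GL ι F) : IsUnit P.valᵀ := by
  rw [isUnit_transpose]; exact P.isUnit

theorem isUnit_mul_mul_iff {M : Type*} [Monoid M] {a b c : M} (ha : IsUnit a) (hc : IsUnit c) :
    IsUnit (a * b * c) ↔ IsUnit b := by
  obtain ⟨u, rfl⟩ := ha
  obtain ⟨v, rfl⟩ := hc
  rw [Units.isUnit_mul_units, Units.isUnit_units_mul]

theorem isUnit_congruence_iff (P : GL ι F) (D : Matrix ι ι F) :
    IsUnit (congruence P D) ↔ IsUnit D :=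
  isUnit_mul_mul_iff P.isUnit (isUnit_transpose_val P)

variable (F) in
/-- Symmetric invertible matrices. -/
abbrev SymInv (ι : Type*) [Fintype ι] [DecidableEq ι] : Type _ :=
  {S : Matrix ι ι F // Sᵀ = S ∧ IsUnit S}

variable (F ι) in
/-- The two descriptions of invertible symmetric matrices agree. -/
noncomputable def symGLEquiv : SymGL F ι ≃ SymInv F ι where
  toFun S := ⟨S.1.val, S.2, S.1.isUnit⟩
  invFun S := ⟨S.2.2.unit, S.2.1⟩
  left_inv S := by ext; simp
  right_inv S := rfl

theorem card_symInv_congr (e : κ ≃ ι) : Nat.card (SymInv F ι) = Nat.card (SymInv F κ) :=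
  Nat.card_congr <| (reindex e.symm e.symm).subtypeEquiv fun S => by
    refine and_congr ((reindex e.symm e.symm).injective.eq_iff (a := Sᵀ) (b := S)).symm ?_
    exact (isUnit_submatrix_equiv e e).symm

/-- The Schur complement `D ↦ D - ᵗB H⁻¹ B` is a translation preserving symmetry, and it detects
invertibility of the block matrix. -/
theorem card_schur (H : SymInv F α) (B : Matrix α κ F) :
    Nat.card {D : Matrix κ κ F // Dᵀ = D ∧ IsUnit (fromBlocks H.1 B Bᵀ D)} =
      Nat.card (SymInv F κ) := by
  have := H.2.2.invertible
  have hs : (Bᵀ * ⅟H.1 * B)ᵀ = Bᵀ * ⅟H.1 * B := by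
    rw [transpose_mul, transpose_mul, transpose_transpose, Matrix.mul_assoc, invOf_eq_nonsing_inv,
      transpose_nonsing_inv, H.2.1]
  refine Nat.card_congr <| (Equiv.subRight (Bᵀ * ⅟H.1 * B)).subtypeEquiv fun D => ?_
  rw [isUnit_fromBlocks_iff_of_invertible₁₁, Equiv.subRight_apply, transpose_sub, hs, sub_left_inj]

/-- A symmetric matrix bordered by a scalar and a vector. -/
def bordered (c : F) (v : κ → F) (D : Matrix κ κ F) : Matrix (Unit ⊕ κ) (Unit ⊕ κ) F :=
  fromBlocks (of fun _ _ => c) (replicateRow Unit v) (replicateRow Unit v)ᵀ D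

theorem bordered_symm_iff (c : F) (v : κ → F) (D : Matrix κ κ F) :
    (bordered c v D)ᵀ = bordered c v D ↔ Dᵀ = D := by
  rw [bordered, fromBlocks_transpose, fromBlocks_inj]
  simp only [transpose_transpose, true_and]
  exact and_iff_right rfl

/-- Symmetric matrices as bordered matrices. -/
def borderedEquiv :
    (F × (κ → F)) × {D : Matrix κ κ F // Dᵀ = D} ≃
      {S : Matrix (Unit ⊕ κ) (Unit ⊕ κ) F // Sᵀ = S} where
  toFun p := ⟨bordered p.1.1 p.1.2 p.2.1, (bordered_symm_iff _ _ _).2 p.2.2⟩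
  invFun S := ((S.1 (.inl ()) (.inl ()), fun j => S.1 (.inl ()) (.inr j)),
    ⟨S.1.toBlocks₂₂, by ext i j; exact congrFun (congrFun S.2 (.inr i)) (.inr j)⟩)
  left_inv p := rfl
  right_inv S := by
    apply Subtype.ext
    ext i j
    rcases i with i | i <;> rcases j with j | j
    · rfl
    · rfl
    · exact congrFun (congrFun S.2 (.inr i)) (.inl j)
    · rfl

theorem isUnit_of_unit {c : F} (hc : c ≠ 0) : IsUnit (of fun _ _ => c : Matrix Unit Unit F) := by
  rw [isUnit_iff_isUnit_det]
  simpa using hc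

variable (κ) in
/-- The number of symmetric `D` such that the bordered matrix is invertible. -/
noncomputable def borderedCount (c : F) (v : κ → F) : ℕ :=
  Nat.card {D : Matrix κ κ F // Dᵀ = D ∧ IsUnit (bordered c v D)}

theorem borderedCount_of_ne_zero {c : F} (hc : c ≠ 0) (v : κ → F) :
    borderedCount κ c v = Nat.card (SymInv F κ) :=
  card_schur ⟨of fun _ _ => c, rfl, isUnit_of_unit hc⟩ (replicateRow Unit v)

theorem borderedCount_zero_zero : borderedCount κ (0 : F) 0 = 0 := by
  rw [borderedCount, Nat.card_eq_zero]
  left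
  constructor
  rintro ⟨D, -, hD⟩
  rw [isUnit_iff_isUnit_det, isUnit_iff_ne_zero] at hD
  refine hD (det_eq_zero_of_row_eq_zero (.inl ()) fun j => ?_)
  rcases j with j | j <;> rfl

/-- Congruence by `diag(1, P)` sends the border `v` to `Pv` and the block `D` to `P D ᵗP`. Hence all
nonzero borders have the same count. -/
theorem borderedCount_zero_mulVec (P : GL κ F) (v : κ → F) :
    borderedCount κ 0 (P.val *ᵥ v) = borderedCount κ 0 v := by
  symm
  refine Nat.card_congr <| (congruence P).subtypeEquiv fun D => ?_
  rw [transpose_congruence_eq_iff]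
  refine and_congr_right fun _ => ?_
  have h : bordered 0 (P.val *ᵥ v) (congruence P D) =
      congruence (lowerGL (1 : GL Unit F) P 0) (bordered 0 v D) := by
    rw [congruence_apply (lowerGL _ _ _), coe_lowerGL, bordered, bordered, fromBlocks_transpose,
      fromBlocks_multiply, fromBlocks_multiply, fromBlocks_inj]
    refine ⟨?_, ?_, ?_, ?_⟩
    · simp
    · simp [replicateRow_mulVec]
    · simp [replicateRow_mulVec]
    · simp [congruence_apply]
  rw [h, isUnit_congruence_iff]

variable [Finite F]

theorem card_symm_and (P : Matrix (Unit ⊕ κ) (Unit ⊕ κ) F → Prop) :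
    Nat.card {S // Sᵀ = S ∧ P S} =
      Nat.card {p : (F × (κ → F)) × Matrix κ κ F //
        p.2ᵀ = p.2 ∧ P (bordered p.1.1 p.1.2 p.2)} := by
  rw [← Nat.card_congr (Equiv.subtypeSubtypeEquivSubtypeInter _ _),
    ← Nat.card_congr (borderedEquiv.subtypeEquiv fun p => Iff.rfl)]
  exact Nat.card_congr
    { toFun := fun p => ⟨(p.1.1, p.1.2.1), p.1.2.2, p.2⟩
      invFun := fun p => ⟨(p.1.1, ⟨p.1.2, p.2.1⟩), p.2.2⟩
      left_inv := fun p => rfl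
      right_inv := fun p => rfl }

theorem card_symInv_sum_and (P : F → Prop) :
    Nat.card {S : SymInv F (Unit ⊕ κ) // P (S.1 (.inl ()) (.inl ()))} =
      Nat.card {p : (F × (κ → F)) × Matrix κ κ F // P p.1.1 ∧ p.2ᵀ = p.2 ∧
        IsUnit (bordered p.1.1 p.1.2 p.2)} := by
  rw [Nat.card_congr (Equiv.subtypeSubtypeEquivSubtypeInter _
    fun S : Matrix (Unit ⊕ κ) (Unit ⊕ κ) F => P (S (.inl ()) (.inl ())))]
  simp only [and_assoc]
  rw [card_symm_and fun S => IsUnit S ∧ P (S (.inl ()) (.inl ()))]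
  refine Nat.card_congr (Equiv.subtypeEquivRight fun p => ?_)
  change _ ∧ _ ∧ P p.1.1 ↔ _
  tauto

variable (F κ) in
/-- The number of invertible symmetric matrices with vanishing corner entry. -/
noncomputable def cornerZeroCount : ℕ :=
  Nat.card {S : SymInv F (Unit ⊕ κ) // S.1 (.inl ()) (.inl ()) = 0}

theorem cornerZeroCount_eq_sum [Fintype F] :
    cornerZeroCount F κ = ∑ v : κ → F, borderedCount κ 0 v := by
  rw [cornerZeroCount, card_symInv_sum_and (· = 0)]
  have e : Nat.card {p : (F × (κ → F)) × Matrix κ κ F // p.1.1 = 0 ∧ p.2ᵀ = p.2 ∧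
        IsUnit (bordered p.1.1 p.1.2 p.2)} =
      Nat.card {p : (κ → F) × Matrix κ κ F // p.2ᵀ = p.2 ∧ IsUnit (bordered 0 p.1 p.2)} :=
    Nat.card_congr
      { toFun := fun p => ⟨(p.1.1.2, p.1.2), p.2.2.1, by simpa only [p.2.1] using p.2.2.2⟩
        invFun := fun p => ⟨((0, p.1.1), p.1.2), rfl, p.2.1, p.2.2⟩
        left_inv := fun p => Subtype.ext (Prod.ext (Prod.ext p.2.1.symm rfl) rfl)
        right_inv := fun p => rfl }
  rw [e, card_subtype_prod]
  rfl

/-- The first term collects the `q - 1` nonzero corner entries with arbitrary border, each completed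
by a Schur complement; the second is the case of zero corner. -/
theorem card_symInv_unit_sum :
    Nat.card (SymInv F (Unit ⊕ κ)) =
      (Nat.card F - 1) * Nat.card F ^ Nat.card κ * Nat.card (SymInv F κ) + cornerZeroCount F κ := by
  classical
  have := Fintype.ofFinite F
  have h := card_symInv_sum_and (F := F) (κ := κ) fun _ => True
  simp only [true_and] at h
  rw [Nat.card_congr (Equiv.subtypeUnivEquiv fun _ => trivial), card_subtype_prod,
    Fintype.sum_prod_type, Fintype.sum_eq_add_sum_compl 0] at h
  have h1 : ∀ c ∈ ({0}ᶜ : Finset F), ∑ v : κ → F, Nat.card {D : Matrix κ κ F // Dᵀ = D ∧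
      IsUnit (bordered c v D)} = Nat.card F ^ Nat.card κ * Nat.card (SymInv F κ) := by
    intro c hc
    have hc : c ≠ 0 := by simpa using hc
    refine (Finset.sum_congr rfl fun v _ => borderedCount_of_ne_zero hc v).trans ?_
    rw [Finset.sum_const, smul_eq_mul, Finset.card_univ, ← Nat.card_eq_fintype_card, Nat.card_fun]
  rw [h, cornerZeroCount_eq_sum, Finset.sum_congr rfl h1, Finset.sum_const, add_comm]
  congr 1
  rw [Finset.card_compl, Finset.card_singleton, ← Nat.card_eq_fintype_card, smul_eq_mul, mul_assoc]

theorem cornerZeroCount_of_isEmpty [IsEmpty κ] : cornerZeroCount F κ = 0 := by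
  have := Fintype.ofFinite F
  rw [cornerZeroCount_eq_sum]
  refine Finset.sum_eq_zero fun v _ => ?_
  rw [Subsingleton.elim v 0, borderedCount_zero_zero]

theorem isUnit_hyperbolic (a : F) : IsUnit (bordered (κ := Unit) 0 1 (of fun _ _ => a)) := by
  rw [isUnit_iff_exists]
  refine ⟨bordered (-a) 1 0, ?_, ?_⟩ <;>
  · ext i j
    rcases i with i | i <;> rcases j with j | j <;>
      simp [bordered, Matrix.mul_apply]

/-- With corner 0 and border `e₁`, the upper left `2 × 2` block is `[[0, 1], [1, a]]`, invertible
for every `a`. Its Schur complement leaves an invertible symmetric matrix, while `a` and the rest of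
its row are free, which gives the power of `q`. -/
theorem borderedCount_single :
    borderedCount (Unit ⊕ κ) (0 : F) (Pi.single (.inl ()) 1) =
      Nat.card F ^ (Nat.card κ + 1) * Nat.card (SymInv F κ) := by
  classical
  have := Fintype.ofFinite F
  have key (x : F × (κ → F)) : Nat.card {D : Matrix κ κ F // Dᵀ = D ∧
      IsUnit (bordered 0 (Pi.single (.inl ()) 1) (bordered x.1 x.2 D))} =
      Nat.card (SymInv F κ) := by
    rw [← card_schur (κ := κ) (⟨bordered 0 1 (of fun _ _ => x.1), (bordered_symm_iff _ _ _).2 rfl,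
      isUnit_hyperbolic _⟩ : SymInv F (Unit ⊕ Unit)) (fromRows 0 (replicateRow Unit x.2))]
    refine Nat.card_congr (Equiv.subtypeEquivRight fun D => and_congr_right fun _ => ?_)
    rw [← isUnit_submatrix_equiv (Equiv.sumAssoc Unit Unit κ) (Equiv.sumAssoc Unit Unit κ)]
    apply iff_of_eq
    congr 1
    ext i j
    rcases i with (i | i) | i <;> rcases j with (j | j) | j <;> simp [bordered]
  rw [borderedCount, card_symm_and fun S => IsUnit (bordered 0 (Pi.single (.inl ()) 1) S),
    card_subtype_prod, Finset.sum_congr rfl fun x _ => key x, Finset.sum_const, Finset.card_univ,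
    ← Nat.card_eq_fintype_card, Nat.card_prod, Nat.card_fun, smul_eq_mul, pow_succ']

theorem cornerZeroCount_unit_sum :
    cornerZeroCount F (Unit ⊕ κ) = (Nat.card F ^ (Nat.card κ + 1) - 1) *
      (Nat.card F ^ (Nat.card κ + 1) * Nat.card (SymInv F κ)) := by
  classical
  have := Fintype.ofFinite F
  rw [cornerZeroCount_eq_sum, Fintype.sum_eq_add_sum_compl 0, borderedCount_zero_zero, zero_add]
  have h1 : ∀ v ∈ ({0}ᶜ : Finset (Unit ⊕ κ → F)), borderedCount (Unit ⊕ κ) 0 v =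
      Nat.card F ^ (Nat.card κ + 1) * Nat.card (SymInv F κ) := by
    intro v hv
    rw [eq_of_GL_invariant borderedCount_zero_mulVec (.inl ()) (by simpa using hv),
      borderedCount_single]
  rw [Finset.sum_congr rfl h1, Finset.sum_const, Finset.card_compl, Finset.card_singleton,
    ← Nat.card_eq_fintype_card, smul_eq_mul, Nat.card_fun, Nat.card_sum]
  simp [add_comm]

/-- The vector 0 admits every `S`. A nonzero vector is moved to `e₁` by `GL`, with `S` transformed
by congruence, and the condition at `e₁` says that the corner entry of `S` is zero. -/
theorem quadCount_zero :
    quadCount F (Unit ⊕ κ) 0 = Nat.card (SymInv F (Unit ⊕ κ)) +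
      (Nat.card F ^ (Nat.card κ + 1) - 1) * cornerZeroCount F κ := by
  classical
  have := Fintype.ofFinite F
  let f : (Unit ⊕ κ → F) → ℕ := fun v => Nat.card {S : SymInv F (Unit ⊕ κ) // v ⬝ᵥ S.1 *ᵥ v = 0}
  have e : quadCount F (Unit ⊕ κ) 0 = Nat.card {y : (Unit ⊕ κ → F) × SymInv F (Unit ⊕ κ) //
      y.1 ⬝ᵥ y.2.1 *ᵥ y.1 = 0} :=
    Nat.card_congr <| ((Equiv.prodComm _ _).trans
      (Equiv.prodCongr (.refl _) (symGLEquiv F _))).subtypeEquiv fun y => Iff.rfl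
  have hf0 : f 0 = Nat.card (SymInv F (Unit ⊕ κ)) :=
    Nat.card_congr (Equiv.subtypeUnivEquiv fun S => by simp)
  have hinv : ∀ (P : GL (Unit ⊕ κ) F) v, f (P.val *ᵥ v) = f v := by
    intro P v
    obtain ⟨T, hT⟩ := isUnit_transpose_val P
    refine Nat.card_congr <| ((congruence T).subtypeEquiv fun S =>
      (and_congr (transpose_congruence_eq_iff T S) (isUnit_congruence_iff T S)).symm).subtypeEquiv
        fun S => ?_
    change _ ↔ v ⬝ᵥ (congruence T S.1) *ᵥ v = 0
    rw [congruence_apply, hT, transpose_transpose, ← mulVec_mulVec, ← mulVec_mulVec,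
      dotProduct_mulVec v, vecMul_transpose]
  have hsingle : f (Pi.single (.inl ()) 1) = cornerZeroCount F κ :=
    Nat.card_congr (Equiv.subtypeEquivRight fun S => by simp)
  rw [e, card_subtype_prod]
  change ∑ v, f v = _
  rw [Fintype.sum_eq_add_sum_compl 0, hf0]
  have h1 : ∀ v ∈ ({0}ᶜ : Finset (Unit ⊕ κ → F)), f v = cornerZeroCount F κ := by
    intro v hv
    rw [eq_of_GL_invariant hinv (.inl ()) (by simpa using hv), hsingle]
  rw [Finset.sum_congr rfl h1, Finset.sum_const, Finset.card_compl, Finset.card_singleton,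
    ← Nat.card_eq_fintype_card, smul_eq_mul, Nat.card_fun, Nat.card_sum]
  simp [add_comm]

/-- All pairs `(S, v)` are sorted by the value of the form; the `q - 1` nonzero values are equally
frequent. -/
theorem quadCount_zero_add :
    quadCount F ι 0 + (Nat.card F - 1) * quadCount F ι 1 =
      Nat.card (SymInv F ι) * Nat.card F ^ Nat.card ι := by
  classical
  have := Fintype.ofFinite F
  have e := Nat.card_congr (Equiv.sigmaFiberEquiv fun y : SymGL F ι × (ι → F) =>
    y.2 ⬝ᵥ y.1.1.val *ᵥ y.2)
  rw [Nat.card_sigma, Nat.card_prod, Nat.card_congr (symGLEquiv F ι), Nat.card_fun] at e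
  change ∑ c : F, quadCount F ι c = _ at e
  rw [← e, Fintype.sum_eq_add_sum_compl 0]
  have h1 : ∀ c ∈ ({0}ᶜ : Finset F), quadCount F ι c = quadCount F ι 1 := by
    intro c hc
    exact quadCount_eq_of_ne_zero (by simpa using hc)
  rw [Finset.sum_congr rfl h1, Finset.sum_const, Finset.card_compl, Finset.card_singleton,
    ← Nat.card_eq_fintype_card, smul_eq_mul]

end Symmetric

/-! ### Closed formulas over `Fin n`. -/

section ClosedForms

variable {F : Type*} [Field F] {ι κ : Type*} [Fintype ι] [DecidableEq ι] [Fintype κ]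
  [DecidableEq κ]

theorem quadCount_congr (e : κ ≃ ι) (c : F) : quadCount F ι c = quadCount F κ c := by
  have h1 (S : GL ι F) : S.valᵀ = S.val ↔ (reindexGL e S).valᵀ = (reindexGL e S).val :=
    ((reindex e.symm e.symm).injective.eq_iff (a := S.valᵀ) (b := S.val)).symm
  refine Nat.card_congr <| (Equiv.prodCongr ((reindexGL e).subtypeEquiv h1)
    (e.symm.arrowCongr (.refl F))).subtypeEquiv fun y => ?_
  change _ ↔ (y.2 ∘ e) ⬝ᵥ (y.1.1.val.submatrix e e) *ᵥ (y.2 ∘ e) = c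
  rw [submatrix_mulVec_comp, comp_equiv_dotProduct_comp_equiv]

/-- `Fin (n + 1)` with its first element split off. -/
def finSuccUnitEquiv (n : ℕ) : Unit ⊕ Fin n ≃ Fin (n + 1) :=
  (Equiv.sumComm _ _).trans
    ((Equiv.sumCongr (.refl _) (Equiv.ofUnique Unit (Fin 1))).trans finSumFinEquiv)

variable [Finite F]

theorem one_le_card_pow (n : ℕ) : 1 ≤ Nat.card F ^ n := Nat.one_le_pow _ _ Nat.card_pos

theorem card_symInv_zero : Nat.card (SymInv F (Fin 0)) = 1 := by
  rw [Nat.card_eq_one_iff_unique]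
  exact ⟨⟨fun _ _ => Subtype.ext (Subsingleton.elim _ _)⟩,
    ⟨⟨1, transpose_one, isUnit_one⟩⟩⟩

theorem card_symInv_one : (Nat.card (SymInv F (Fin 1)) : ℚ) = Nat.card F - 1 := by
  rw [card_symInv_congr (finSuccUnitEquiv 0), card_symInv_unit_sum, cornerZeroCount_of_isEmpty,
    card_symInv_zero]
  have := one_le_card_pow (F := F) 1
  rw [pow_one] at this
  push_cast [Nat.cast_sub this]
  simp

theorem cast_cornerZeroCount (n : ℕ) :
    (cornerZeroCount F (Unit ⊕ Fin n) : ℚ) = ((Nat.card F : ℚ) ^ (n + 1) - 1) *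
      ((Nat.card F : ℚ) ^ (n + 1) * Nat.card (SymInv F (Fin n))) := by
  rw [cornerZeroCount_unit_sum, Nat.card_fin]
  push_cast [Nat.cast_sub (one_le_card_pow (F := F) (n + 1))]
  rfl

/-- `Fin (n + 2)` with its first two elements split off. -/
def finSuccSuccUnitEquiv (n : ℕ) : Unit ⊕ (Unit ⊕ Fin n) ≃ Fin (n + 2) :=
  (Equiv.sumCongr (.refl _) (finSuccUnitEquiv n)).trans (finSuccUnitEquiv (n + 1))

theorem card_symInv_add_two (n : ℕ) :
    (Nat.card (SymInv F (Fin (n + 2))) : ℚ) =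
      (Nat.card F - 1) * (Nat.card F : ℚ) ^ (n + 1) * Nat.card (SymInv F (Fin (n + 1))) +
        ((Nat.card F : ℚ) ^ (n + 1) - 1) *
          ((Nat.card F : ℚ) ^ (n + 1) * Nat.card (SymInv F (Fin n))) := by
  rw [card_symInv_congr (finSuccSuccUnitEquiv n), card_symInv_unit_sum, Nat.cast_add,
    cast_cornerZeroCount, card_symInv_congr (finSuccUnitEquiv n)]
  have := one_le_card_pow (F := F) 1
  rw [pow_one] at this
  push_cast [Nat.cast_sub this]
  simp [add_comm]

/-- The recursion has order two, so even and odd sizes are handled in one induction. -/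
theorem card_symInv_closed (m : ℕ) :
    (Nat.card (SymInv F (Fin (2 * m))) : ℚ) = (Nat.card F : ℚ) ^ (m * (m + 1)) *
        ∏ j ∈ Finset.Icc 1 m, ((Nat.card F : ℚ) ^ (2 * j - 1) - 1) ∧
      (Nat.card (SymInv F (Fin (2 * m + 1))) : ℚ) = (Nat.card F : ℚ) ^ (m * (m + 1)) *
        ∏ j ∈ Finset.Icc 1 (m + 1), ((Nat.card F : ℚ) ^ (2 * j - 1) - 1) := by
  induction m with
  | zero =>
    constructor
    · simp [card_symInv_zero]
    · simp [card_symInv_one]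
  | succ m ih =>
    obtain ⟨h1, h2⟩ := ih
    have h3 : (Nat.card (SymInv F (Fin (2 * (m + 1)))) : ℚ) =
        (Nat.card F : ℚ) ^ ((m + 1) * (m + 1 + 1)) *
          ∏ j ∈ Finset.Icc 1 (m + 1), ((Nat.card F : ℚ) ^ (2 * j - 1) - 1) := by
      rw [show 2 * (m + 1) = 2 * m + 2 by ring, card_symInv_add_two, h1, h2,
        Finset.prod_Icc_succ_top (by omega), show 2 * (m + 1) - 1 = 2 * m + 1 by omega]
      ring
    refine ⟨h3, ?_⟩
    rw [show 2 * (m + 1) + 1 = 2 * m + 1 + 2 by ring, card_symInv_add_two, h2,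
      show 2 * m + 1 + 1 = 2 * (m + 1) by ring, h3, Finset.prod_Icc_succ_top (b := m + 1) (by omega),
      show 2 * (m + 1 + 1) - 1 = 2 * m + 3 by omega]
    ring

theorem card_symInv_even_succ (m : ℕ) :
    (Nat.card (SymInv F (Fin (2 * m + 2))) : ℚ) = (Nat.card F : ℚ) ^ (2 * m + 2) *
      ((Nat.card F : ℚ) ^ (2 * m + 1) - 1) * Nat.card (SymInv F (Fin (2 * m))) := by
  rw [show 2 * m + 2 = 2 * (m + 1) by ring, (card_symInv_closed (m + 1)).1,
    (card_symInv_closed m).1, Finset.prod_Icc_succ_top (by omega),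
    show 2 * (m + 1) - 1 = 2 * m + 1 by omega]
  ring

theorem cast_quadCount_zero_add (n : ℕ) :
    (quadCount F (Fin n) 0 : ℚ) + (Nat.card F - 1) * quadCount F (Fin n) 1 =
      Nat.card (SymInv F (Fin n)) * (Nat.card F : ℚ) ^ n := by
  have h := quadCount_zero_add (F := F) (ι := Fin n)
  have := one_le_card_pow (F := F) 1
  rw [pow_one] at this
  have h' := congrArg (Nat.cast (R := ℚ)) h
  push_cast [Nat.cast_sub this] at h'
  simpa using h'

theorem one_lt_cast_card : (1 : ℚ) < Nat.card F := by
  exact_mod_cast Finite.one_lt_card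

/-- In positive even size exactly `1/q` of the invertible symmetric matrices have zero corner entry,
by `card_symInv_even_succ`. With this, `quadCount_zero` and `quadCount_zero_add` determine both
counts. Size 0 is separate: the only value of the form is 0. -/
theorem quadCount_zero_eq (m : ℕ) :
    (quadCount F (Fin (2 * m)) 0 : ℚ) = quadCount F (Fin (2 * m)) 1 +
      Nat.card (SymInv F (Fin (2 * m))) := by
  have hq := one_lt_cast_card (F := F)
  have hsum := cast_quadCount_zero_add (F := F) (2 * m)
  rcases m with _ | m
  · have h1 : quadCount F (Fin (2 * 0)) 1 = 0 := by
      rw [quadCount, Nat.card_eq_zero]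
      left
      constructor
      rintro ⟨y, hy⟩
      simp [dotProduct] at hy
    rw [h1] at hsum ⊢
    simpa using hsum
  · have hc : Nat.card (Unit ⊕ Fin (2 * m)) + 1 = 2 * m + 2 := by
      rw [Nat.card_sum, Nat.card_fin, Nat.card_unique]; omega
    have h0 : (quadCount F (Fin (2 * (m + 1))) 0 : ℚ) =
        Nat.card (SymInv F (Fin (2 * (m + 1)))) + ((Nat.card F : ℚ) ^ (2 * m + 2) - 1) *
          (((Nat.card F : ℚ) ^ (2 * m + 1) - 1) *
            ((Nat.card F : ℚ) ^ (2 * m + 1) * Nat.card (SymInv F (Fin (2 * m))))) := by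
      rw [show 2 * (m + 1) = 2 * m + 2 by ring, quadCount_congr (finSuccSuccUnitEquiv (2 * m)),
        quadCount_zero, hc, ← card_symInv_congr (finSuccSuccUnitEquiv (2 * m)), Nat.cast_add,
        Nat.cast_mul, cast_cornerZeroCount, Nat.cast_sub (one_le_card_pow (2 * m + 2)), Nat.cast_pow,
        Nat.cast_one]
    have hs := card_symInv_even_succ (F := F) m
    rw [show 2 * (m + 1) = 2 * m + 2 by ring] at hsum h0 ⊢
    set q := (Nat.card F : ℚ)
    -- The sum over all values gives the `1`-count only with coefficient `q - 1`, so the identity is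
    -- first proved with that factor.
    have : (q - 1) * ((quadCount F (Fin (2 * m + 2)) 0 : ℚ) - quadCount F (Fin (2 * m + 2)) 1 -
      Nat.card (SymInv F (Fin (2 * m + 2)))) = 0 := by
      linear_combination q * h0 - hsum - (q ^ (2 * m + 2) - 1) * hs
    have h2 := (mul_eq_zero.1 this).resolve_left (by linarith)
    linarith

theorem card_mul_quadCount_one (m : ℕ) :
    (Nat.card F : ℚ) * quadCount F (Fin (2 * m)) 1 =
      Nat.card (SymInv F (Fin (2 * m))) * ((Nat.card F : ℚ) ^ (2 * m) - 1) := by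
  linear_combination cast_quadCount_zero_add (F := F) (2 * m) - quadCount_zero_eq (F := F) m

theorem cast_card_GL (n : ℕ) :
    (Nat.card (GL (Fin n) F) : ℚ) =
      ∏ i ∈ Finset.range n, ((Nat.card F : ℚ) ^ n - (Nat.card F : ℚ) ^ i) := by
  have := Fintype.ofFinite F
  rw [card_GL_field, ← Fin.prod_univ_eq_prod_range (fun i => (Nat.card F : ℚ) ^ n -
    (Nat.card F : ℚ) ^ i), Nat.cast_prod, Nat.card_eq_fintype_card]
  refine Finset.prod_congr rfl fun i _ => ?_
  rw [Nat.cast_sub (Nat.pow_le_pow_right Fintype.card_pos i.2.le)]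
  push_cast
  rfl

theorem card_GL_succ (n : ℕ) :
    (Nat.card (GL (Fin (n + 1)) F) : ℚ) =
      (Nat.card F : ℚ) ^ n * ((Nat.card F : ℚ) ^ (n + 1) - 1) * Nat.card (GL (Fin n) F) := by
  rw [cast_card_GL, cast_card_GL, Finset.prod_range_succ', pow_zero,
    Finset.prod_congr rfl fun i _ => show (Nat.card F : ℚ) ^ (n + 1) - (Nat.card F : ℚ) ^ (i + 1) =
      (Nat.card F : ℚ) * ((Nat.card F : ℚ) ^ n - (Nat.card F : ℚ) ^ i) by ring,
    Finset.prod_mul_distrib, Finset.prod_const, Finset.card_range]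
  ring

theorem card_GL_zero : Nat.card (GL (Fin 0) F) = 1 := by
  simp

theorem card_GL_one : (Nat.card (GL (Fin 1) F) : ℚ) = Nat.card F - 1 := by
  rw [card_GL_succ, card_GL_zero]; simp

theorem card_GL_two : (Nat.card (GL (Fin 2) F) : ℚ) =
    Nat.card F * ((Nat.card F : ℚ) ^ 2 - 1) * (Nat.card F - 1) := by
  rw [card_GL_succ, card_GL_one]; ring

end ClosedForms

/-! ### Counting `T` in `GL₁` and `GL₂` by `Tr T + Tr T⁻¹`. -/

section Kloosterman

variable {F : Type*} [Field F]

/-- Invertible `1 × 1` matrices. -/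
def unitsEquivGLOne : Fˣ ≃ GL (Fin 1) F where
  toFun u := ⟨of fun _ _ => u, of fun _ _ => u⁻¹, by ext i j; fin_cases i; fin_cases j; simp [Matrix.mul_apply],
    by ext i j; fin_cases i; fin_cases j; simp [Matrix.mul_apply]⟩
  invFun A := ⟨A.val 0 0, (A⁻¹).val 0 0, by
      have := congrFun (congrFun A.mul_inv 0) 0
      simpa [Matrix.mul_apply] using this, by
      have := congrFun (congrFun A.inv_mul 0) 0
      simpa [Matrix.mul_apply] using this⟩
  left_inv u := by ext; rfl
  right_inv A := by
    ext i j
    fin_cases i; fin_cases j; rfl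

theorem kloostermanCount_one (γ : F) : kloostermanCount F (Fin 1) γ = delta 1 γ := by
  rw [delta, ← Nat.card_coe_set_eq]
  refine Nat.card_congr <| (unitsEquivGLOne.symm.trans
    (Equiv.funUnique (Fin 1) Fˣ).symm).subtypeEquiv fun A => ?_
  change _ ↔ ∑ i : Fin 1, (A.val 0 0 + (A⁻¹).val 0 0) = γ
  simp [Matrix.trace]

theorem trace_inv_fin_two (T : GL (Fin 2) F) :
    (T⁻¹).val.trace = T.val.trace * T.val.det⁻¹ := by
  rw [coe_units_inv, inv_def, adjugate_fin_two, trace_smul, trace_fin_two, trace_fin_two,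
    Ring.inverse_eq_inv']
  simp
  ring

variable [Finite F]

theorem card_mul_eq (s : F) [Decidable (s = 0)] :
    Nat.card {x : F × F // x.1 * x.2 = s} =
      (Nat.card F - 1) + if s = 0 then Nat.card F else 0 := by
  classical
  have := Fintype.ofFinite F
  rw [card_subtype_prod, Fintype.sum_eq_add_sum_compl 0]
  have h1 : ∀ b ∈ ({0}ᶜ : Finset F), Nat.card {c : F // b * c = s} = 1 := by
    intro b hb
    have hb : b ≠ 0 := by simpa using hb
    rw [Nat.card_eq_one_iff_unique]
    refine ⟨⟨fun x y => Subtype.ext (mul_left_cancel₀ hb (x.2.trans y.2.symm))⟩,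
      ⟨⟨b⁻¹ * s, by field_simp⟩⟩⟩
  rw [Finset.sum_congr rfl h1, Finset.sum_const, Finset.card_compl, Finset.card_singleton,
    ← Nat.card_eq_fintype_card, smul_eq_mul, mul_one, add_comm]
  congr 1
  split_ifs with h
  · subst h
    exact Nat.card_congr (Equiv.subtypeUnivEquiv fun c => zero_mul c)
  · rw [Nat.card_eq_zero]
    left
    exact ⟨fun x => h (by rw [← x.2, zero_mul])⟩

/-- The upper left entry `x` fixes the other diagonal entry, and the off-diagonal entries have
product `x(t - x) - d`. Such a product equation has `q - 1` solutions, and `q` more when the right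
side is 0, that is, when `x` is a root of the characteristic polynomial. -/
theorem card_trace_det_fin_two (t d : F) :
    Nat.card {M : Matrix (Fin 2) (Fin 2) F // M.trace = t ∧ M.det = d} =
      Nat.card F * (Nat.card F - 1) + Nat.card F * Nat.card {x : F // x * (t - x) = d} := by
  classical
  have := Fintype.ofFinite F
  have e : Nat.card {M : Matrix (Fin 2) (Fin 2) F // M.trace = t ∧ M.det = d} =
      Nat.card {p : F × (F × F) // p.2.1 * p.2.2 = p.1 * (t - p.1) - d} := by
    refine Nat.card_congr
      { toFun := fun M => ⟨(M.1 0 0, M.1 0 1, M.1 1 0), ?_⟩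
        invFun := fun p => ⟨!![p.1.1, p.1.2.1; p.1.2.2, t - p.1.1], ?_, ?_⟩
        left_inv := fun M => ?_
        right_inv := fun p => rfl }
    · have h1 := M.2.1
      have h2 := M.2.2
      rw [trace_fin_two] at h1
      rw [det_fin_two] at h2
      linear_combination M.1 0 0 * h1 - h2
    · simp [trace_fin_two]
    · rw [det_fin_two_of, p.2]; ring
    · have h1 := M.2.1
      rw [trace_fin_two] at h1
      apply Subtype.ext
      ext i j
      fin_cases i <;> fin_cases j <;> simp [← h1]
  rw [e, card_subtype_prod, Finset.sum_congr rfl fun a _ => card_mul_eq (a * (t - a) - d),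
    Finset.sum_add_distrib, Finset.sum_const, Finset.card_univ, ← Nat.card_eq_fintype_card,
    smul_eq_mul, card_eq_sum_ite, Finset.mul_sum]
  congr 1
  refine Finset.sum_congr rfl fun a _ => ?_
  simp [sub_eq_zero]

/-- The equation is `t(1 + d⁻¹) = γ`: one solution `t` for each unit `d ≠ -1`, and for `d = -1` all
`t` or none according to whether `γ = 0`. -/
theorem card_trace_det_pairs (γ : F) [Decidable (γ = 0)] :
    (Nat.card {w : Fˣ × F // w.2 + w.2 * (w.1 : F)⁻¹ = γ} : ℚ) =
      Nat.card F - 2 + if γ = 0 then (Nat.card F : ℚ) else 0 := by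
  classical
  have := Fintype.ofFinite F
  rw [card_subtype_prod, Fintype.sum_eq_add_sum_compl (-1)]
  have h1 : ∀ d ∈ ({-1}ᶜ : Finset Fˣ), Nat.card {t : F // t + t * (d : F)⁻¹ = γ} = 1 := by
    intro d hd
    have hd : d ≠ -1 := by simpa using hd
    have hd' : 1 + (d : F)⁻¹ ≠ 0 := by
      intro h
      apply hd
      ext
      have := d.ne_zero
      field_simp at h
      rw [mul_zero] at h
      simpa using eq_neg_of_add_eq_zero_left h
    rw [Nat.card_eq_one_iff_unique]
    refine ⟨⟨fun x y => Subtype.ext (mul_right_cancel₀ hd' ?_)⟩,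
      ⟨⟨γ * (1 + (d : F)⁻¹)⁻¹, ?_⟩⟩⟩
    · linear_combination x.2 - y.2
    · rw [← mul_one_add, mul_assoc, inv_mul_cancel₀ hd', mul_one]
  have h2 : Fintype.card Fˣ = Nat.card F - 1 := by
    rw [Fintype.card_units, Nat.card_eq_fintype_card]
  have h3 : 2 ≤ Nat.card F := Finite.one_lt_card
  have h4 : Nat.card {t : F // t + t * ((-1 : Fˣ) : F)⁻¹ = γ} = if γ = 0 then Nat.card F else 0 := by
    split_ifs with h
    · subst h
      exact Nat.card_congr (Equiv.subtypeUnivEquiv fun c => by simp)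
    · rw [Nat.card_eq_zero]
      left
      exact ⟨fun x => h (by rw [← x.2]; simp)⟩
  rw [h4, Finset.sum_congr rfl h1, Finset.sum_const, Finset.card_compl, Finset.card_singleton, h2,
    smul_eq_mul, mul_one, Nat.sub_sub, Nat.cast_add, Nat.cast_sub h3, add_comm]
  push_cast
  rfl

/-- A root `x` of the characteristic polynomial corresponds to the ordered pair `(x, t - x)` of
eigenvalues. Their product is `d`, so the sum of their inverses is `t / d`. -/
theorem card_trace_det_roots (γ : F) :
    Nat.card {p : {w : Fˣ × F // w.2 + w.2 * (w.1 : F)⁻¹ = γ} × F //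
      p.2 * (p.1.1.2 - p.2) = p.1.1.1} = delta 2 γ := by
  rw [delta, ← Nat.card_coe_set_eq]
  refine Nat.card_congr
    { toFun := fun p =>
        have hne := (p.2 ▸ p.1.1.1.1.ne_zero : p.1.2 * (p.1.1.1.2 - p.1.2) ≠ 0)
        ⟨![Units.mk0 _ (left_ne_zero_of_mul hne), Units.mk0 _ (right_ne_zero_of_mul hne)], ?_⟩
      invFun := fun α => ⟨(⟨(α.1 0 * α.1 1, α.1 0 + α.1 1), ?_⟩, α.1 0), ?_⟩
      left_inv := fun p => ?_
      right_inv := fun α => ?_ }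
  · have h1 := p.1.1.2
    have h2 := p.2
    rw [← h2] at h1
    have hx := left_ne_zero_of_mul hne
    have hy := right_ne_zero_of_mul hne
    change ∑ i : Fin 2, _ = γ
    simp only [Fin.sum_univ_two, cons_val_zero, cons_val_one, Units.val_mk0, Units.val_inv_eq_inv_val]
    refine Eq.trans ?_ h1
    field_simp
    ring
  · have h : ∑ i, ((α.1 i : F) + (((α.1 i)⁻¹ : Fˣ) : F)) = γ := α.2
    rw [Fin.sum_univ_two] at h
    refine Eq.trans ?_ h
    simp only [Units.val_mul, Units.val_inv_eq_inv_val]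
    field_simp
    ring
  · simp
  · apply Subtype.ext
    refine Prod.ext (Subtype.ext (Prod.ext (Units.ext ?_) ?_)) rfl
    · simpa using p.2
    · simp
  · apply Subtype.ext
    ext i
    fin_cases i <;> simp

/-- `Tr T⁻¹ = Tr T / det T`, so the condition depends only on determinant and trace. Each admissible
pair contributes `q(q - 1)` matrices plus `q` for each root, and summing the roots gives `δ(2, q;
γ)`. -/
theorem kloostermanCount_two (γ : F) [Decidable (γ = 0)] :
    (kloostermanCount F (Fin 2) γ : ℚ) = Nat.card F * delta 2 γ +
      (Nat.card F * (Nat.card F - 1)) *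
        (Nat.card F - 2 + if γ = 0 then (Nat.card F : ℚ) else 0) := by
  classical
  have := Fintype.ofFinite F
  let W := {w : Fˣ × F // w.2 + w.2 * (w.1 : F)⁻¹ = γ}
  let f : {T : GL (Fin 2) F // T.val.trace + (T⁻¹).val.trace = γ} → W := fun T =>
    ⟨(GeneralLinearGroup.det T.1, T.1.val.trace), by
      have := T.2
      rwa [trace_inv_fin_two] at this⟩
  have hfib (w : W) : Nat.card {T // f T = w} =
      Nat.card F * (Nat.card F - 1) +
        Nat.card F * Nat.card {x : F // x * (w.1.2 - x) = w.1.1} := by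
    rw [← card_trace_det_fin_two]
    have hf (T) : f T = w ↔ T.1.val.trace = w.1.2 ∧ T.1.val.det = w.1.1 := by
      rw [Subtype.ext_iff, Prod.ext_iff, Units.ext_iff, and_comm]
      rfl
    have hu (M : {M : Matrix (Fin 2) (Fin 2) F // M.trace = w.1.2 ∧ M.det = w.1.1}) :
        IsUnit M.1 := by
      rw [isUnit_iff_isUnit_det, M.2.2]
      exact w.1.1.isUnit
    exact Nat.card_congr
      { toFun := fun T => ⟨T.1.1.val, (hf _).1 T.2⟩
        invFun := fun M => ⟨⟨(hu M).unit, by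
            rw [trace_inv_fin_two, IsUnit.unit_spec, M.2.1, M.2.2]
            exact w.2⟩, (hf _).2 M.2⟩
        left_inv := fun T => by
          apply Subtype.ext
          apply Subtype.ext
          ext
          rfl
        right_inv := fun M => rfl }
  have h : kloostermanCount F (Fin 2) γ =
      Nat.card W * (Nat.card F * (Nat.card F - 1)) + Nat.card F * delta 2 γ := by
    rw [kloostermanCount, ← Nat.card_congr (Equiv.sigmaFiberEquiv f), Nat.card_sigma,
      Finset.sum_congr rfl fun w _ => hfib w, Finset.sum_add_distrib, Finset.sum_const,
      Finset.card_univ, ← Nat.card_eq_fintype_card, smul_eq_mul, ← Finset.mul_sum,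
      ← card_trace_det_roots, card_subtype_prod (α := W)]
  have h3 : 1 ≤ Nat.card F := Nat.card_pos
  rw [h, ← card_trace_det_pairs]
  push_cast [Nat.cast_sub h3]
  ring

end Kloosterman

/-! ### Assembling the trace distributions. -/

section Main

variable {F : Type*} [Field F] [Finite F]

theorem two_ne_zero_of_three_eq_zero (h3 : (3 : F) = 0) : (2 : F) ≠ 0 := by
  intro h
  exact one_ne_zero (α := F) (by linear_combination h3 - h)

/-- The count for a general block split `n = 2m + k`, in cross-multiplied form. Evenness of `2m`
enters through `quadCount_zero_eq` and `card_mul_quadCount_one`, which eliminate both form counts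
and leave the count of `T` as the only term involving β. -/
theorem N_doubleCoset_sigma (h3 : (3 : F) = 0) (m k : ℕ) (β : F) :
    (Nat.card F : ℚ) * (Nat.card F : ℚ) ^ k *
        N (DoubleCoset.doubleCoset (sigma (2 * m + k) F (2 * m)) (Q (2 * m + k) F)
          (Q (2 * m + k) F)) β *
        (Nat.card (GL (Fin (2 * m)) F) * Nat.card (GL (Fin k) F) *
          (Nat.card F : ℚ) ^ (2 * m * k)) =
      Nat.card (GL (Fin (2 * m + k)) F) * Nat.card (Antisymm F (Fin (2 * m))) *
        (Nat.card F : ℚ) ^ (2 * m + k) * Nat.card (Antisymm F (Fin (2 * m + k))) *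
        (Nat.card (GL (Fin (2 * m + k)) F) * (Nat.card F : ℚ) ^ (2 * m + k) +
          (Nat.card F : ℚ) ^ (2 * m * k + k) * Nat.card (SymInv F (Fin (2 * m))) *
            (Nat.card F * kloostermanCount F (Fin k) (β - 1) - Nat.card (GL (Fin k) F))) := by
  have h2 := two_ne_zero_of_three_eq_zero h3
  have E1 := N_doubleCoset_mul_card (n := 2 * m + k) h3 (2 * m) β
  rw [card_isStab_topId, card_traceEq_topId, card_isStab] at E1
  have E2 := card_traceEq h2
    (fromBlocks 1 0 0 0 : Matrix (Fin (2 * m) ⊕ Fin k) (Fin (2 * m) ⊕ Fin k) F) β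
  have E3 := card_subtype_add_card_not (fun x : GL (Fin (2 * m) ⊕ Fin k) F ×
    (Fin (2 * m) ⊕ Fin k → F) => (fromBlocks 1 0 0 0 * x.1.val)ᵀ = fromBlocks 1 0 0 0 * x.1.val)
  rw [card_symmetricUpper, Nat.card_congr (symGLEquiv F _)] at E3
  rw [card_symmetricUpper_diagonalTrace] at E2
  have E6 := card_quad_add_kloosterman (F := F) (m := Fin (2 * m)) (k := Fin k) (β - 1)
  have E7 := quadCount_zero_eq (F := F) m
  have E8 := card_mul_quadCount_one (F := F) m
  have hG : Nat.card (GL (Fin (2 * m) ⊕ Fin k) F) = Nat.card (GL (Fin (2 * m + k)) F) :=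
    (Nat.card_congr (reindexGL finSumFinEquiv)).symm
  have hA : Nat.card (Antisymm F (Fin (2 * m) ⊕ Fin k)) =
      Nat.card (Antisymm F (Fin (2 * m + k))) := card_antisymm_congr finSumFinEquiv
  have hA' := card_antisymm_sum (F := F) (Fin (2 * m)) (Fin k)
  rw [hA] at hA' E2
  rw [Nat.card_prod, hG, Nat.card_fun] at E3
  rw [Nat.card_prod, Nat.card_prod, Nat.card_fun] at E1
  simp only [Nat.card_sum, Nat.card_fin] at E1 E2 E3 hA'
  generalize Nat.card {x : GL (Fin (2 * m) ⊕ Fin k) F × (Fin (2 * m) ⊕ Fin k → F) //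
    ¬ (fromBlocks 1 0 0 0 * x.1.val)ᵀ = fromBlocks 1 0 0 0 * x.1.val} = ns at E2 E3
  generalize Nat.card {y : GL (Fin k) F × (SymGL F (Fin (2 * m)) × (Fin (2 * m) → F)) //
    y.2.2 ⬝ᵥ y.2.1.1.val *ᵥ y.2.2 + (y.1.val.trace + (y.1⁻¹).val.trace) = β - 1} = Y at E2 E6
  generalize Nat.card {p : ParabolicParam F (Fin (2 * m) ⊕ Fin k) //
    TraceEq (fromBlocks 1 0 0 0) β p} = cnt at E1 E2
  have hAk : (Nat.card (Antisymm F (Fin k)) : ℚ) ≠ 0 := by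
    have : Nonempty (Antisymm F (Fin k)) := ⟨⟨0, by simp⟩⟩
    exact_mod_cast Nat.card_pos.ne'
  have hq : (Nat.card F : ℚ) ≠ 0 := by exact_mod_cast Nat.card_pos.ne'
  replace E1 := congrArg (Nat.cast (R := ℚ)) E1
  replace E2 := congrArg (Nat.cast (R := ℚ)) E2
  replace E3 := congrArg (Nat.cast (R := ℚ)) E3
  replace E6 := congrArg (Nat.cast (R := ℚ)) E6
  replace hA' := congrArg (Nat.cast (R := ℚ)) hA'
  push_cast at E1 E2 E3 E6 hA'
  generalize (N (DoubleCoset.doubleCoset (sigma (2 * m + k) F (2 * m)) (Q (2 * m + k) F)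
          (Q (2 * m + k) F)) β : ℚ) = NN at *
  generalize (Nat.card F : ℚ) = q at *
  generalize (Nat.card (GL (Fin (2 * m + k)) F) : ℚ) = Gn at *
  generalize (Nat.card (GL (Fin (2 * m)) F) : ℚ) = Gr at *
  generalize (Nat.card (GL (Fin k) F) : ℚ) = Gk at *
  generalize (Nat.card (Antisymm F (Fin (2 * m + k))) : ℚ) = An at *
  generalize (Nat.card (Antisymm F (Fin (2 * m))) : ℚ) = Ar at *
  generalize (Nat.card (Antisymm F (Fin k)) : ℚ) = Ak at *
  generalize (Nat.card (SymInv F (Fin (2 * m))) : ℚ) = S at *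
  generalize (quadCount F (Fin (2 * m)) 0 : ℚ) = T0 at *
  generalize (quadCount F (Fin (2 * m)) 1 : ℚ) = T1 at *
  generalize (kloostermanCount F (Fin k) (β - 1) : ℚ) = K at *
  have hY : q * Y = S * (q ^ (2 * m) - 1) * Gk + q * S * K := by
    linear_combination q * E6 + Gk * E8 + q * K * E7
  have hcnt : q * cnt = An * (Gn * q ^ (2 * m + k) +
      q ^ (2 * m * k + k) * S * (q * K - Gk)) := by
    have e1 : q ^ (k * (2 * m)) = q ^ (2 * m * k) := by rw [mul_comm]
    rw [e1] at E2 E3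
    rw [E2]
    linear_combination An * E3 + An * q ^ (2 * m * k) * q ^ k * hY
  -- This factor occurs on both sides once the antisymmetric matrices of size `2m + k` are counted
  -- by blocks.
  refine mul_right_cancel₀ (mul_ne_zero hAk (pow_ne_zero (2 * m * k) hq)) ?_
  have e1 : q ^ (k * (2 * m)) = q ^ (2 * m * k) := by rw [mul_comm]
  rw [e1] at E1
  linear_combination q * E1 + Gn * An * q ^ (2 * m + k) * hcnt +
    Gn * q ^ (2 * m + k) * An * (Gn * q ^ (2 * m + k) +
      q ^ (2 * m * k + k) * S * (q * K - Gk)) * hA'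

/-- The factor `q ^ m` avoids the exponent `m(2m - 1)` and its truncated subtraction. -/
theorem card_antisymm_even (h2 : (2 : F) ≠ 0) (m : ℕ) :
    (Nat.card (Antisymm F (Fin (2 * m))) : ℚ) * (Nat.card F : ℚ) ^ m =
      (Nat.card F : ℚ) ^ (2 * m * m) := by
  rw [card_antisymm_fin h2, Nat.cast_pow, ← pow_add]
  congr 1
  rw [mul_assoc, Nat.mul_div_cancel_left _ two_pos]
  rcases m with _ | m
  · rfl
  · rw [show 2 * (m + 1) - 1 = 2 * m + 1 by omega]; ring

theorem card_antisymm_odd (h2 : (2 : F) ≠ 0) (m : ℕ) :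
    (Nat.card (Antisymm F (Fin (2 * m + 1))) : ℚ) = (Nat.card F : ℚ) ^ ((2 * m + 1) * m) := by
  rw [card_antisymm_fin h2, Nat.cast_pow]
  congr 1
  rw [show 2 * m + 1 - 1 = 2 * m by omega, mul_left_comm, Nat.mul_div_cancel_left _ two_pos]

/-- This identifies `B⁻` as the ratio of the orders of `GL_{2m+1}` and of the set of invertible
symmetric matrices of size `2m`; it arises from the equidistributed main term. -/
theorem prod_formula_GL_odd (m : ℕ) :
    (Nat.card (GL (Fin (2 * m + 1)) F) : ℚ) =
      (Nat.card (SymInv F (Fin (2 * m))) : ℚ) * Bminus (2 * m + 1) (Nat.card F) := by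
  rw [(card_symInv_closed m).1, Bminus, show (2 * m + 1 - 1) / 2 = m by omega,
    show (2 * m + 1 - 1) ^ 2 / 4 = m ^ 2 by
      rw [show 2 * m + 1 - 1 = 2 * m by omega, mul_pow]; omega]
  induction m with
  | zero => simp [card_GL_one]
  | succ m ih =>
    rw [show 2 * (m + 1) + 1 = 2 * m + 1 + 1 + 1 by ring, card_GL_succ, card_GL_succ, ih,
      Finset.prod_Icc_succ_top (by omega), Finset.prod_Icc_succ_top (by omega),
      show 2 * (m + 1) - 1 = 2 * m + 1 by omega]
    ring

theorem prod_formula_GL_even (m : ℕ) :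
    (Nat.card (GL (Fin (2 * m + 2)) F) : ℚ) = (Nat.card F : ℚ) ^ (2 * m + 1) *
      (Nat.card (SymInv F (Fin (2 * m))) : ℚ) * Bplus (2 * m + 2) (Nat.card F) := by
  rw [card_GL_succ, prod_formula_GL_odd, Bminus, Bplus, show (2 * m + 1 - 1) / 2 = m by omega,
    show 2 * m + 1 - 1 = 2 * m by omega, show 2 * m + 2 - 2 = 2 * m by omega,
    show 2 * m / 2 = m by omega, show 2 * m + 2 - 1 = 2 * m + 1 by omega]
  ring

theorem N_DC1minus (h3 : (3 : F) = 0) (m : ℕ) (β : F) :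
    (N (DC1minus (2 * m + 1) F) β : ℚ) =
      (Nat.card F : ℚ)⁻¹ * Aminus (2 * m + 1) (Nat.card F) * Bminus (2 * m + 1) (Nat.card F) +
      (Nat.card F : ℚ)⁻¹ * Aminus (2 * m + 1) (Nat.card F) *
        (Nat.card F * delta 1 (β - 1) - Nat.card F + 1) := by
  have h2 := two_ne_zero_of_three_eq_zero h3
  have h := N_doubleCoset_sigma h3 m 1 β
  change _ * (N (DC1minus (2 * m + 1) F) β : ℚ) * _ = _ at h
  have hG := prod_formula_GL_odd (F := F) m
  have hGs := card_GL_succ (F := F) (2 * m)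
  have hA := card_antisymm_even h2 m
  have hS := (card_symInv_closed (F := F) m).1
  have hGr : (Nat.card (GL (Fin (2 * m)) F) : ℚ) ≠ 0 := by exact_mod_cast Nat.card_pos.ne'
  have hq1 := one_lt_cast_card (F := F)
  rw [kloostermanCount_one, card_GL_one, card_antisymm_odd h2] at h
  -- `A⁻` with the denominator of its `q`-binomial cleared.
  have hAm : Aminus (2 * m + 1) (Nat.card F) * ((Nat.card F : ℚ) - 1) =
      (Nat.card F : ℚ) ^ (5 * m ^ 2 + 5 * m + 1) * ((Nat.card F : ℚ) ^ (2 * m + 1) - 1) *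
        ∏ j ∈ Finset.Icc 1 m, ((Nat.card F : ℚ) ^ (2 * j - 1) - 1) := by
    rw [Aminus, qBinom, show (2 * m + 1 - 1) / 2 = m by omega,
      show (5 * (2 * m + 1) ^ 2 - 1) / 4 = 5 * m ^ 2 + 5 * m + 1 by
        rw [show 5 * (2 * m + 1) ^ 2 = 4 * (5 * m ^ 2 + 5 * m + 1) + 1 by ring]; omega]
    have : (Nat.card F : ℚ) - 1 ≠ 0 := by linarith
    simp only [Finset.prod_range_one, Nat.sub_zero, pow_one]
    field_simp
  generalize (N (DC1minus (2 * m + 1) F) β : ℚ) = NN at *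
  generalize Aminus (2 * m + 1) (Nat.card F) = A at *
  generalize Bminus (2 * m + 1) (Nat.card F) = B at *
  generalize (∏ j ∈ Finset.Icc 1 m, ((Nat.card F : ℚ) ^ (2 * j - 1) - 1)) = P at *
  generalize (Nat.card (GL (Fin (2 * m + 1)) F) : ℚ) = Gn at *
  generalize (Nat.card (GL (Fin (2 * m)) F) : ℚ) = Gr at *
  generalize (Nat.card (Antisymm F (Fin (2 * m))) : ℚ) = Ar at *
  generalize (Nat.card (SymInv F (Fin (2 * m))) : ℚ) = S at *
  generalize (delta 1 (β - 1) : ℚ) = K at *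
  generalize (Nat.card F : ℚ) = q at *
  have hq : q ≠ 0 := by positivity
  have hq' : q - 1 ≠ 0 := by linarith
  have key : NN * q * (q - 1) = q ^ (5 * m ^ 2 + 5 * m + 1) * (q ^ (2 * m + 1) - 1) * P *
      (B + (q * K - q + 1)) := by
    refine mul_right_cancel₀ (b := Gr * q ^ (2 * m) * q ^ m * q) (by positivity) ?_
    linear_combination q ^ m * h +
      Gn * Ar * q ^ m * q ^ (2 * m + 1) * q ^ ((2 * m + 1) * m) * q ^ (2 * m + 1) * hG +
      Gn * q ^ (2 * m + 1) * q ^ ((2 * m + 1) * m) * q ^ (2 * m + 1) * S *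
        (B + (q * K - q + 1)) * hA +
      q ^ (2 * m * m) * q ^ (2 * m + 1) * q ^ ((2 * m + 1) * m) * q ^ (2 * m + 1) * S *
        (B + (q * K - q + 1)) * hGs +
      q ^ (2 * m * m) * q ^ (2 * m + 1) * q ^ ((2 * m + 1) * m) * q ^ (2 * m + 1) *
        (q ^ (2 * m) * (q ^ (2 * m + 1) - 1) * Gr) * (B + (q * K - q + 1)) * hS
  have key2 : NN * q = A * (B + (q * K - q + 1)) := by
    refine mul_right_cancel₀ hq' ?_
    linear_combination key - (B + (q * K - q + 1)) * hAm
  field_simp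
  linear_combination key2

theorem N_DC1plus (h3 : (3 : F) = 0) (m : ℕ) (β : F) :
    (N (DC1plus (2 * m + 2) F) β : ℚ) =
      (Nat.card F : ℚ)⁻¹ * Aplus (2 * m + 2) (Nat.card F) * Bplus (2 * m + 2) (Nat.card F) +
      (Nat.card F : ℚ)⁻¹ * Aplus (2 * m + 2) (Nat.card F) *
        (kloostermanCount F (Fin 2) (β - 1) -
          (Nat.card F : ℚ)⁻¹ * Nat.card (GL (Fin 2) F)) := by
  have h2 := two_ne_zero_of_three_eq_zero h3
  have h := N_doubleCoset_sigma h3 m 2 β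
  change _ * (N (DC1plus (2 * m + 2) F) β : ℚ) * _ = _ at h
  have hG := prod_formula_GL_even (F := F) m
  have hGs := card_GL_succ (F := F) (2 * m)
  have hGss := card_GL_succ (F := F) (2 * m + 1)
  rw [hGs] at hGss
  have hA := card_antisymm_even h2 m
  have hA' := card_antisymm_even h2 (m + 1)
  rw [show 2 * (m + 1) = 2 * m + 2 by ring] at hA'
  have hS := (card_symInv_closed (F := F) m).1
  have hGr : (Nat.card (GL (Fin (2 * m)) F) : ℚ) ≠ 0 := by exact_mod_cast Nat.card_pos.ne'
  have hq1 := one_lt_cast_card (F := F)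
  have hq2 : 0 < (Nat.card F : ℚ) ^ 2 - 1 := by nlinarith
  have hG2 := card_GL_two (F := F)
  -- `A⁺` with the denominator of its `q`-binomial cleared; up to a factor `q` that denominator is
  -- the order of `GL₂`.
  have hAp : Aplus (2 * m + 2) (Nat.card F) * (((Nat.card F : ℚ) ^ 2 - 1) * (Nat.card F - 1)) =
      (Nat.card F : ℚ) ^ (5 * m ^ 2 + 9 * m + 4) * (((Nat.card F : ℚ) ^ (2 * m + 2) - 1) *
        ((Nat.card F : ℚ) ^ (2 * m + 1) - 1)) *
        ∏ j ∈ Finset.Icc 1 m, ((Nat.card F : ℚ) ^ (2 * j - 1) - 1) := by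
    rw [Aplus, qBinom, show (2 * m + 2 - 2) / 2 = m by omega,
      show (5 * (2 * m + 2) ^ 2 - 2 * (2 * m + 2)) / 4 = 5 * m ^ 2 + 9 * m + 4 by
        rw [show 5 * (2 * m + 2) ^ 2 = 4 * (5 * m ^ 2 + 9 * m + 4) + 2 * (2 * m + 2) by ring]
        omega]
    have h1 : (Nat.card F : ℚ) - 1 ≠ 0 := by linarith
    rw [Finset.prod_range_succ, Finset.prod_range_one, Nat.sub_zero, Nat.sub_zero,
      show 2 * m + 2 - 1 = 2 * m + 1 by omega, show 2 - 1 = 1 by rfl, pow_one]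
    field_simp
  generalize (N (DC1plus (2 * m + 2) F) β : ℚ) = NN at *
  generalize Aplus (2 * m + 2) (Nat.card F) = A at *
  generalize Bplus (2 * m + 2) (Nat.card F) = B at *
  generalize (∏ j ∈ Finset.Icc 1 m, ((Nat.card F : ℚ) ^ (2 * j - 1) - 1)) = P at *
  generalize (Nat.card (GL (Fin (2 * m + 2)) F) : ℚ) = Gn at *
  generalize (Nat.card (GL (Fin (2 * m + 1 + 1)) F) : ℚ) = Gn' at *
  generalize (Nat.card (GL (Fin (2 * m)) F) : ℚ) = Gr at *
  generalize (Nat.card (GL (Fin 2) F) : ℚ) = G2 at *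
  generalize (Nat.card (Antisymm F (Fin (2 * m))) : ℚ) = Ar at *
  generalize (Nat.card (Antisymm F (Fin (2 * m + 2))) : ℚ) = An at *
  generalize (Nat.card (SymInv F (Fin (2 * m))) : ℚ) = S at *
  generalize (kloostermanCount F (Fin 2) (β - 1) : ℚ) = K at *
  generalize (Nat.card F : ℚ) = q at *
  have hq : q ≠ 0 := by positivity
  have hq' : q - 1 ≠ 0 := by linarith
  have key : NN * q * q * ((q ^ 2 - 1) * (q - 1)) = q ^ (5 * m ^ 2 + 9 * m + 4) *
      ((q ^ (2 * m + 2) - 1) * (q ^ (2 * m + 1) - 1)) * P * (q * B + q * K - G2) := by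
    refine mul_right_cancel₀ (b := Gr * q ^ (4 * m) * q ^ (2 * m + 1) * q ^ 2) (by positivity) ?_
    linear_combination q ^ m * q ^ (m + 1) * h -
      NN * Gr * q ^ (4 * m) * q ^ (2 * m + 1) * q ^ 3 * hG2 +
      Gn * Ar * q ^ m * An * q ^ (m + 1) * q ^ (2 * m + 2) * q ^ (2 * m + 2) * hG +
      Gn * An * q ^ (m + 1) * q ^ (2 * m + 2) * q ^ (4 * m + 2) * S *
        (q * B + q * K - G2) * hA +
      Gn * q ^ (2 * m * m) * q ^ (2 * m + 2) * q ^ (4 * m + 2) * S *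
        (q * B + q * K - G2) * hA' +
      q ^ (2 * m * m) * q ^ ((2 * m + 2) * (m + 1)) * q ^ (2 * m + 2) * q ^ (4 * m + 2) * S *
        (q * B + q * K - G2) * hGss +
      q ^ (2 * m * m) * q ^ ((2 * m + 2) * (m + 1)) * q ^ (2 * m + 2) * q ^ (4 * m + 2) *
        (q ^ (2 * m + 1) * (q ^ (2 * m + 2) - 1) * (q ^ (2 * m) * (q ^ (2 * m + 1) - 1) * Gr)) *
        (q * B + q * K - G2) * hS
  have key2 : NN * q * q = A * (q * B + q * K - G2) := by
    refine mul_right_cancel₀ (mul_ne_zero hq2.ne' hq') ?_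
    linear_combination key - (q * B + q * K - G2) * hAp
  field_simp
  linear_combination key2

/-! ### Evaluating `δ(1, q; γ)`, and passing to the cosets `ρQσQ`. -/

theorem delta_neg (m : ℕ) (γ : F) : delta m (-γ) = delta m γ := by
  rw [delta, delta, ← Nat.card_coe_set_eq, ← Nat.card_coe_set_eq]
  refine Nat.card_congr <| (Equiv.neg (Fin m → Fˣ)).subtypeEquiv fun α => ?_
  change ∑ i, _ = _ ↔ ∑ i, _ = _
  rw [← neg_inj, neg_neg, ← Finset.sum_neg_distrib]
  apply iff_of_eq
  congr 1
  refine Finset.sum_congr rfl fun i _ => ?_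
  simp [inv_neg]
  ring

/-- The equation is `α² - γα + 1 = 0`. In characteristic 3 its discriminant is `γ² - 4 = γ² - 1` and
`1/2 = -1`, so the roots are `±y - γ` with `y² = γ² - 1`, and the two are mutually inverse. -/
theorem delta_one_eq (h3 : (3 : F) = 0) (γ : F) :
    delta 1 γ = Nat.card {y : F // y ^ 2 = γ ^ 2 - 1} := by
  rw [delta, ← Nat.card_coe_set_eq]
  have hx (x : {y : F // y ^ 2 = γ ^ 2 - 1}) : (x.1 - γ) * (- x.1 - γ) = 1 := by
    linear_combination -x.2
  refine Nat.card_congr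
    { toFun := fun α => ⟨(α.1 0 : F) + γ, ?_⟩
      invFun := fun x => ⟨fun _ => ⟨x.1 - γ, - x.1 - γ, hx x, by rw [mul_comm, hx]⟩, ?_⟩
      left_inv := fun α => ?_
      right_inv := fun x => ?_ }
  · have h : ∑ i, ((α.1 i : F) + (((α.1 i)⁻¹ : Fˣ) : F)) = γ := α.2
    rw [Fin.sum_univ_one] at h
    have h1 := (α.1 0).mul_inv
    linear_combination ((α.1 0 : F)) * h - h1 + ((α.1 0 : F)) * γ * h3
  · change ∑ i : Fin 1, (x.1 - γ + (- x.1 - γ)) = γ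
    rw [Fin.sum_univ_one]
    linear_combination -γ * h3
  · apply Subtype.ext
    ext i
    fin_cases i
    simp
  · simp

theorem delta_one_of_eq_zero (h3 : (3 : F) = 0) {γ : F} (h : γ ^ 2 - 1 = 0) : delta 1 γ = 1 := by
  rw [delta_one_eq h3, h, Nat.card_eq_one_iff_unique]
  exact ⟨⟨fun x y => Subtype.ext (by rw [pow_eq_zero_iff two_ne_zero |>.1 x.2,
    pow_eq_zero_iff two_ne_zero |>.1 y.2])⟩, ⟨⟨0, by simp⟩⟩⟩

theorem delta_one_of_not_isSquare (h3 : (3 : F) = 0) {γ : F} (h : ¬ IsSquare (γ ^ 2 - 1)) :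
    delta 1 γ = 0 := by
  rw [delta_one_eq h3, Nat.card_eq_zero]
  left
  exact ⟨fun y => h ⟨y.1, y.2.symm.trans (sq y.1)⟩⟩

theorem delta_one_of_isSquare (h3 : (3 : F) = 0) {γ : F} (h0 : γ ^ 2 - 1 ≠ 0)
    (h : IsSquare (γ ^ 2 - 1)) : delta 1 γ = 2 := by
  obtain ⟨s, hs⟩ := h
  have hs0 : s ≠ 0 := by rintro rfl; simp [hs] at h0
  have hne : s ≠ -s := by
    intro h
    have : (2 : F) * s = 0 := by linear_combination h
    simp [hs0, two_ne_zero_of_three_eq_zero h3] at this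
  rw [delta_one_eq h3]
  refine Eq.trans ?_ (Set.ncard_pair hne)
  rw [← Nat.card_coe_set_eq]
  refine Nat.card_congr (Equiv.subtypeEquivRight fun y => ?_)
  rw [hs, ← sq, sq_eq_sq_iff_eq_or_eq_neg]
  rfl

variable (n : ℕ) in
/-- The negative of `ρ` lies in `Q`. -/
theorem exists_mem_Q_neg_rho : ∃ z ∈ QSubgroup n F, toMat (rho n F) = - toMat z := by
  have h : (parabolicMat (-1 : Matrix (Fin n) (Fin n) F) 0 (-1) 0 0)ᵀ * JMat n F *
      parabolicMat (-1 : Matrix (Fin n) (Fin n) F) 0 (-1) 0 0 = JMat n F := by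
    rw [transpose_J_parabolicMat_eq_iff]
    simp
  obtain ⟨z, hz⟩ := exists_toMat_eq h
  refine ⟨z, (mem_Q_iff z).2 ⟨_, _, _, _, _, hz⟩, ?_⟩
  rw [hz]
  change fromBlocks (1 : Matrix (Fin n ⊕ Fin n) (Fin n ⊕ Fin n) F) 0 0 (-1) = _
  rw [parabolicMat, ← fromBlocks_one, fromBlocks_neg, fromBlocks_neg]
  simp

/-- Writing `ρ = -z` with `z ∈ Q` and absorbing `z` into the left factor of the double coset gives
`ρQσQ = -QσQ`, so traces change sign. -/
theorem N_rho_doubleCoset {n : ℕ} (σ : OGroup n F) (β : F) :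
    N ((fun w => rho n F * w) '' DoubleCoset.doubleCoset σ (Q n F) (Q n F)) β =
      N (DoubleCoset.doubleCoset σ (Q n F) (Q n F)) (-β) := by
  obtain ⟨z, hz, hzr⟩ := exists_mem_Q_neg_rho (F := F) n
  have htr (v : OGroup n F) : toMat (rho n F * (z⁻¹ * v)) = - toMat v := by
    rw [toMat_mul, hzr, Matrix.neg_mul, ← toMat_mul, mul_inv_cancel_left]
  have hmem (x : OGroup n F) (hx : x ∈ QSubgroup n F) (v : OGroup n F)
      (hv : v ∈ DoubleCoset.doubleCoset σ (Q n F) (Q n F)) :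
      x * v ∈ DoubleCoset.doubleCoset σ (Q n F) (Q n F) := by
    obtain ⟨a, ha, b, hb, rfl⟩ := DoubleCoset.mem_doubleCoset.1 hv
    exact DoubleCoset.mem_doubleCoset.2 ⟨x * a, (QSubgroup n F).mul_mem hx ha, b, hb, by group⟩
  have himage : {w | w ∈ (fun w => rho n F * w) '' DoubleCoset.doubleCoset σ (Q n F) (Q n F) ∧
      (toMat w).trace = β} = (fun v => rho n F * (z⁻¹ * v)) ''
        {v | v ∈ DoubleCoset.doubleCoset σ (Q n F) (Q n F) ∧ (toMat v).trace = -β} := by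
    ext w
    constructor
    · rintro ⟨⟨v, hv, rfl⟩, hw⟩
      refine ⟨z * v, ⟨hmem z hz v hv, ?_⟩, by simp⟩
      have := htr (z * v)
      rw [inv_mul_cancel_left] at this
      rw [← hw]
      change _ = -(toMat (rho n F * v)).trace
      rw [this, trace_neg, neg_neg]
    · rintro ⟨v, ⟨hv, hvt⟩, rfl⟩
      refine ⟨⟨z⁻¹ * v, hmem _ ((QSubgroup n F).inv_mem hz) v hv, rfl⟩, ?_⟩
      change (toMat (rho n F * (z⁻¹ * v))).trace = β
      rw [htr, trace_neg, hvt, neg_neg]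
  rw [N, N, himage, Set.ncard_image_of_injective]
  intro v w h
  simpa using h

theorem N_DC1plus_eq_one (h3 : (3 : F) = 0) (m : ℕ) :
    (N (DC1plus (2 * m + 2) F) 1 : ℚ) =
      (Nat.card F : ℚ)⁻¹ * Aplus (2 * m + 2) (Nat.card F) * Bplus (2 * m + 2) (Nat.card F) +
      (Nat.card F : ℚ)⁻¹ * Aplus (2 * m + 2) (Nat.card F) *
        (Nat.card F * delta 2 (0 : F) + ((Nat.card F : ℚ) - 1) ^ 3) := by
  classical
  have hq : (Nat.card F : ℚ) ≠ 0 := by exact_mod_cast Nat.card_pos.ne'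
  rw [N_DC1plus h3, sub_self, kloostermanCount_two, if_pos rfl, card_GL_two]
  field_simp
  ring

theorem N_DC1plus_ne_one (h3 : (3 : F) = 0) (m : ℕ) {β : F} (hβ : β ≠ 1) :
    (N (DC1plus (2 * m + 2) F) β : ℚ) =
      (Nat.card F : ℚ)⁻¹ * Aplus (2 * m + 2) (Nat.card F) * Bplus (2 * m + 2) (Nat.card F) +
      (Nat.card F : ℚ)⁻¹ * Aplus (2 * m + 2) (Nat.card F) *
        (Nat.card F * delta 2 (β - 1) - 2 * (Nat.card F : ℚ) ^ 2 + 3 * Nat.card F - 1) := by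
  classical
  have hq : (Nat.card F : ℚ) ≠ 0 := by exact_mod_cast Nat.card_pos.ne'
  rw [N_DC1plus h3, kloostermanCount_two, if_neg (sub_ne_zero.2 hβ), card_GL_two]
  field_simp
  ring

theorem N_DC2minus (n : ℕ) (β : F) : N (DC2minus n F) β = N (DC1minus n F) (-β) :=
  N_rho_doubleCoset _ β

theorem N_DC2plus (n : ℕ) (β : F) : N (DC2plus n F) β = N (DC1plus n F) (-β) :=
  N_rho_doubleCoset _ β

/-- The trace distribution on `DC₁⁻`, with the possible values of the Kloosterman count. -/
theorem N_DC1minus_cases (h3 : (3 : F) = 0) {n : ℕ} (hn : Odd n) (β : F) :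
    (N (DC1minus n F) β : ℚ) =
        (Nat.card F : ℚ)⁻¹ * Aminus n (Nat.card F) * Bminus n (Nat.card F) +
        (Nat.card F : ℚ)⁻¹ * Aminus n (Nat.card F) *
          ((Nat.card F : ℚ) * delta 1 (β - 1) - Nat.card F + 1) ∧
      (β ^ 2 - 2 * β ≠ 0 → IsSquare (β ^ 2 - 2 * β) →
        (N (DC1minus n F) β : ℚ) =
          (Nat.card F : ℚ)⁻¹ * Aminus n (Nat.card F) * Bminus n (Nat.card F) +
          (Nat.card F : ℚ)⁻¹ * Aminus n (Nat.card F) * ((Nat.card F : ℚ) + 1)) ∧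
      (β ^ 2 - 2 * β = 0 →
        (N (DC1minus n F) β : ℚ) =
          (Nat.card F : ℚ)⁻¹ * Aminus n (Nat.card F) * Bminus n (Nat.card F) +
          (Nat.card F : ℚ)⁻¹ * Aminus n (Nat.card F) * 1) ∧
      (¬ IsSquare (β ^ 2 - 2 * β) →
        (N (DC1minus n F) β : ℚ) =
          (Nat.card F : ℚ)⁻¹ * Aminus n (Nat.card F) * Bminus n (Nat.card F) +
          (Nat.card F : ℚ)⁻¹ * Aminus n (Nat.card F) * (-(Nat.card F : ℚ) + 1)) := by
  obtain ⟨m, rfl⟩ := hn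
  -- Completing the square matches the case distinction with `γ² - 1` at `γ = β - 1`.
  have hd : β ^ 2 - 2 * β = (β - 1) ^ 2 - 1 := by ring
  rw [N_DC1minus h3, hd]
  refine ⟨rfl, fun h0 h => ?_, fun h => ?_, fun h => ?_⟩
  · rw [delta_one_of_isSquare h3 h0 h]
    push_cast
    ring
  · rw [delta_one_of_eq_zero h3 h]
    push_cast
    ring
  · rw [delta_one_of_not_isSquare h3 h]
    push_cast
    ring

theorem three_eq_zero_of_card {F : Type*} [Field F] [Fintype F] {r : ℕ}
    (hF : Fintype.card F = 3 ^ r) : (3 : F) = 0 := by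
  have h := Nat.cast_card_eq_zero F
  rw [hF] at h
  push_cast at h
  exact eq_zero_of_pow_eq_zero h

end Main

end DoubleCosetTrace

theorem proposition3p7 (r q : ℕ) (hr : 0 < r) (hq : q = 3 ^ r)
    (F : Type*) [Field F] [Fintype F] (hF : Fintype.card F = q) :
    (∀ n : ℕ, Odd n → ∀ β : F,
      (N (DC1minus n F) β : ℚ) =
        (q : ℚ)⁻¹ * Aminus n q * Bminus n q +
        (q : ℚ)⁻¹ * Aminus n q *
          ((q : ℚ) * delta 1 (β - 1) - q + 1) ∧
      (β ^ 2 - 2 * β ≠ 0 → IsSquare (β ^ 2 - 2 * β) →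
        (N (DC1minus n F) β : ℚ) =
          (q : ℚ)⁻¹ * Aminus n q * Bminus n q +
          (q : ℚ)⁻¹ * Aminus n q * ((q : ℚ) + 1)) ∧
      ((β = 0 ∨ β = 2) →
        (N (DC1minus n F) β : ℚ) =
          (q : ℚ)⁻¹ * Aminus n q * Bminus n q +
          (q : ℚ)⁻¹ * Aminus n q * 1) ∧
      (¬ IsSquare (β ^ 2 - 2 * β) →
        (N (DC1minus n F) β : ℚ) =
          (q : ℚ)⁻¹ * Aminus n q * Bminus n q +
          (q : ℚ)⁻¹ * Aminus n q * (-(q : ℚ) + 1))) ∧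
    (∀ n : ℕ, Odd n → ∀ β : F,
      (N (DC2minus n F) β : ℚ) =
        (q : ℚ)⁻¹ * Aminus n q * Bminus n q +
        (q : ℚ)⁻¹ * Aminus n q *
          ((q : ℚ) * delta 1 (β + 1) - q + 1) ∧
      (β ^ 2 + 2 * β ≠ 0 → IsSquare (β ^ 2 + 2 * β) →
        (N (DC2minus n F) β : ℚ) =
          (q : ℚ)⁻¹ * Aminus n q * Bminus n q +
          (q : ℚ)⁻¹ * Aminus n q * ((q : ℚ) + 1)) ∧
      ((β = 0 ∨ β = 1) →
        (N (DC2minus n F) β : ℚ) =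
          (q : ℚ)⁻¹ * Aminus n q * Bminus n q +
          (q : ℚ)⁻¹ * Aminus n q * 1) ∧
      (¬ IsSquare (β ^ 2 + 2 * β) →
        (N (DC2minus n F) β : ℚ) =
          (q : ℚ)⁻¹ * Aminus n q * Bminus n q +
          (q : ℚ)⁻¹ * Aminus n q * (-(q : ℚ) + 1))) ∧
    (∀ n : ℕ, Even n → 2 ≤ n → ∀ β : F,
      (β = 1 →
        (N (DC1plus n F) β : ℚ) =
          (q : ℚ)⁻¹ * Aplus n q * Bplus n q +
          (q : ℚ)⁻¹ * Aplus n q *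
            ((q : ℚ) * delta 2 (0 : F) + ((q : ℚ) - 1) ^ 3)) ∧
      (β ≠ 1 →
        (N (DC1plus n F) β : ℚ) =
          (q : ℚ)⁻¹ * Aplus n q * Bplus n q +
          (q : ℚ)⁻¹ * Aplus n q *
            ((q : ℚ) * delta 2 (β - 1) - 2 * (q : ℚ) ^ 2 + 3 * q - 1))) ∧
    (∀ n : ℕ, Even n → 2 ≤ n → ∀ β : F,
      (β = -1 →
        (N (DC2plus n F) β : ℚ) =
          (q : ℚ)⁻¹ * Aplus n q * Bplus n q +
          (q : ℚ)⁻¹ * Aplus n q *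
            ((q : ℚ) * delta 2 (0 : F) + ((q : ℚ) - 1) ^ 3)) ∧
      (β ≠ -1 →
        (N (DC2plus n F) β : ℚ) =
          (q : ℚ)⁻¹ * Aplus n q * Bplus n q +
          (q : ℚ)⁻¹ * Aplus n q *
            ((q : ℚ) * delta 2 (β + 1) - 2 * (q : ℚ) ^ 2 + 3 * q - 1))) := by
  have h3 : (3 : F) = 0 := three_eq_zero_of_card (hF.trans hq)
  have hqF : (q : ℚ) = Nat.card F := by rw [Nat.card_eq_fintype_card, hF]
  have hneg (β : F) : -β - 1 = -(β + 1) := by ring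
  have hneg2 (β : F) : (-β) ^ 2 - 2 * (-β) = β ^ 2 + 2 * β := by ring
  have heven {n : ℕ} (hn : Even n) (hn2 : 2 ≤ n) : ∃ m, n = 2 * m + 2 := by
    obtain ⟨m, rfl⟩ := hn
    exact ⟨m - 1, by omega⟩
  rw [hqF]
  refine ⟨fun n hn β => ?_, fun n hn β => ?_, fun n hn hn2 β => ?_, fun n hn hn2 β => ?_⟩
  · obtain ⟨h1, h2, h4, h5⟩ := N_DC1minus_cases h3 hn β
    refine ⟨h1, h2, fun h => h4 ?_, h5⟩
    rcases h with rfl | rfl <;> ring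
  · obtain ⟨h1, h2, h4, h5⟩ := N_DC1minus_cases h3 hn (-β)
    rw [N_DC2minus]
    rw [hneg, delta_neg] at h1
    rw [hneg2] at h2 h4 h5
    refine ⟨h1, h2, fun h => h4 ?_, h5⟩
    rcases h with rfl | rfl
    · ring
    -- At `β = 1` the expression `β² + 2β` is 3, which is zero here.
    · linear_combination h3
  · obtain ⟨m, rfl⟩ := heven hn hn2
    refine ⟨?_, fun h => N_DC1plus_ne_one h3 m h⟩
    rintro rfl
    exact N_DC1plus_eq_one h3 m
  · obtain ⟨m, rfl⟩ := heven hn hn2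
    rw [N_DC2plus]
    constructor
    · rintro rfl
      rw [neg_neg]
      exact N_DC1plus_eq_one h3 m
    · intro h
      rw [N_DC1plus_ne_one h3 m (fun h1 => h (by rw [← h1, neg_neg])), hneg, delta_neg]
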